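/- **Theorem (Skyline Regret).** *Setting.* Let $A\in\mathbb R^{a\times n}$ (source) and $B\in\mathbb R^{b\times n}$ (target) have full row rank, and let $\kappa=\dim(\operatorname{Row}A\cap\operatorname{Row}B)/b$ (with $\kappa=0$ if $b=0$). Users $u\in[U]$ have unknown vectors $\theta^u\in\mathbb R^n$ with $\|\theta^u\|_2\le 1$ and $\|B\theta^u\|_2\le 1$. In round $h=1,\dots,H$ the agent observes a user $u_h$ and a nonempty finite decision set $\mathcal A_h\subset\{x\in\mathbb R^b:\|x\|_2\le1\}$ (both may depend on the past and be random; for each $h$, the size of $\mathcal A_h$ is bounded by a constant), pulls $x_h\in\mathcal A_h$ and receives $X_h=\langle x_h,B\theta^{u_h}\rangle+\eta_h$, where $\eta_h$ has mean $0$, is $1$-subgaussian, and is independent of everything that happened before it, including $u_1,\dots,u_h$ and $\mathcal A_1,\dots,\mathcal A_h$. The expected regret is $R_H=\mathbb E\big[\sum_{h=1}^H(\max_{x\in\mathcal A_h}\langle x,B\theta^{u_h}\rangle-X_h)\big]$. The agent knows $A$, $B$ and $A\theta^u$ for every $u$. *Decomposition.* Let $\begin{bmatrix}A\\B\end{bmatrix}=\mathcal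 U\Sigma\mathcal V^T$ be a compact singular value decomposition ($\mathcal U$, $\mathcal V$ with $r$ orthonormal columns, $\Sigma$ an $r\times r$ diagonal matrix with positive diagonal), let $\pi_A\mathcal U$ and $\pi_B\mathcal U$ be the blocks of the first $a$ and the last $b$ rows of $\mathcal U$, let $D_T=\pi_B\mathcal U(\pi_A\mathcal U)^+$ with $^+$ the Moore–Penrose pseudo-inverse, and let $D_G$ be a matrix whose $d$ columns form an orthonormal basis of $\pi_B\mathcal U\,\operatorname{Null}(\pi_A\mathcal U)$. Such objects exist, and for every choice of them $r=a+(1-\kappa)b$, $d=(1-\kappa)b$, and every $\theta\in\mathbb R^n$ admits exactly one $\psi\in\mathbb R^{(1-\kappa)b}$ with $$B\theta=D_TA\theta+D_G\psi .$$ *Algorithm.* Shifted LinUCB with radii $\rho$ runs one bandit per user. In a round with user $u$ and decision set $\mathcal A$, let $\tau$ range over the past rounds of user $u$, let $t$ be their number, and put $z_\tau=D_G^Tx_\tau$, $V=I+\sum_\tau z_\tau z_\tau^T$ and $\hat\psi=V^{-1}\sum_\tau\big(X_\tau-\langle x_\tau,D_TA\theta^u\rangle\big)z_\tau$. It pulls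 an arm $x\in\mathcal A$ that maximizes $$\langle x,D_TA\theta^u\rangle+\langle D_G^Tx,\hat\psi\rangle+\rho(d,t)\sqrt{(D_G^Tx)^TV^{-1}D_G^Tx},$$ ties being broken by the first maximizer in a listing of $\mathcal A$. *Claim.* There are an absolute constant $C>0$ and a choice of positive radii $\rho(d,t)$, depending on nothing but $d$ and $t$, such that in every such setting with $H\ge 2U$ shifted LinUCB with these radii has regret $$R_H\le C\,(1-\kappa)\,b\,\sqrt{UH}\,\log\frac HU .$$ -/

import Mathlib

open MeasureTheory ProbabilityTheory

noncomputable section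

namespace SkylineBandit

/-- The subspace of `ℝⁿ` spanned by the rows of a matrix. -/
def rowSpace {m n : ℕ} (M : Matrix (Fin m) (Fin n) ℝ) : Submodule ℝ (Fin n → ℝ) :=
  Submodule.span ℝ (Set.range M.row)

/-- The common information `κ = dim (Row A ∩ Row B) / b` of a source and a target matrix. -/
def commonInformation {a b n : ℕ} (A : Matrix (Fin a) (Fin n) ℝ)
    (B : Matrix (Fin b) (Fin n) ℝ) : ℝ :=
  (Module.finrank ℝ (rowSpace A ⊓ rowSpace B : Submodule ℝ (Fin n → ℝ)) : ℝ) / (b : ℝ)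

/-- `P` is the Moore-Penrose pseudo-inverse of the real matrix `M`: the four Penrose equations,
which have exactly one solution `P` for every `M`. -/
structure IsPseudoInverse {p q : ℕ} (M : Matrix (Fin p) (Fin q) ℝ)
    (P : Matrix (Fin q) (Fin p) ℝ) : Prop where
  mul_mul_self : M * P * M = M
  mul_self_mul : P * M * P = P
  symm_left : (M * P).transpose = M * P
  symm_right : (P * M).transpose = P * M

/-- What an agent computes from the source matrix `A` and the target matrix `B`: a compact
singular value decomposition of the stacked matrix `[A; B]`, the pseudo-inverse of the upper block
of its left factor, and an orthonormal basis of the image, under the lower block, of the null space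
of the upper block. `r` is the rank of the stacked matrix and `d` the number of basis vectors. -/
structure Decomposition {a b n : ℕ} (A : Matrix (Fin a) (Fin n) ℝ)
    (B : Matrix (Fin b) (Fin n) ℝ) (r d : ℕ) where
  /-- left singular vectors -/
  left : Matrix (Fin a ⊕ Fin b) (Fin r) ℝ
  /-- nonzero singular values -/
  sing : Fin r → ℝ
  /-- right singular vectors -/
  right : Matrix (Fin n) (Fin r) ℝ
  left_orthonormal : left.transpose * left = 1
  right_orthonormal : right.transpose * right = 1
  sing_pos : ∀ i, 0 < sing i
  svd : Matrix.fromRows A B = left * Matrix.diagonal sing * right.transpose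
  /-- pseudo-inverse of the upper block of `left` -/
  pinv : Matrix (Fin r) (Fin a) ℝ
  pinv_spec : IsPseudoInverse left.toRows₁ pinv
  /-- the generator `D_G` -/
  generator : Matrix (Fin b) (Fin d) ℝ
  generator_orthonormal : generator.transpose * generator = 1
  generator_range : LinearMap.range generator.mulVecLin =
    Submodule.map left.toRows₂.mulVecLin (LinearMap.ker left.toRows₁.mulVecLin)

/-- The transformer `D_T = (π_B 𝒰) (π_A 𝒰)⁺`. -/
def Decomposition.transformer {a b n r d : ℕ} {A : Matrix (Fin a) (Fin n) ℝ}
    {B : Matrix (Fin b) (Fin n) ℝ} (D : Decomposition A B r d) : Matrix (Fin b) (Fin a) ℝ :=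
  D.left.toRows₂ * D.pinv

/-- One past round as the agent sees it: the user, the pulled arm and the observed reward. -/
structure Round (U b : ℕ) where
  user : Fin U
  arm : Fin b → ℝ
  reward : ℝ

/-- A (deterministic, non-anticipating) policy: from the past rounds, most recent first, the current
user and the current nonempty finite decision set, listed as a family, it chooses an arm. -/
def Policy (U b : ℕ) : Type :=
  List (Round U b) → Fin U → (k : ℕ) → (Fin (k + 1) → Fin b → ℝ) → Fin (k + 1)

/-- A contextual linear bandit environment with horizon `H`, `U` users and arms in `ℝᵇ`. -/
structure Environment {Ω : Type*} [mΩ : MeasurableSpace Ω] (P : Measure Ω) (U b H : ℕ) where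
  /-- The information available before the arm of round `h` is pulled. The context and the decision
  set of round `h` may depend on the past in any way (in particular they may be deterministic, or
  random and independent of the noise). -/
  info : Filtration ℕ mΩ
  /-- the user of each round -/
  user : ℕ → Ω → Fin U
  /-- the decision set of round `h` has the `lastArm h + 1` elements `arm h 0, …, arm h (lastArm h)`
  (repetitions allowed) -/
  lastArm : ℕ → ℕ
  arm : (h : ℕ) → Fin (lastArm h + 1) → Ω → (Fin b → ℝ)
  noise : ℕ → Ω → ℝ
  user_measurable : ∀ h < H, Measurable[info h] (user h)
  arm_measurable : ∀ h < H, ∀ k, Measurable[info h] (arm h k)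
  arm_norm_le : ∀ h < H, ∀ k ω, ‖WithLp.toLp 2 (arm h k ω)‖ ≤ 1
  noise_measurable : ∀ h < H, Measurable[info (h + 1)] (noise h)
  noise_indep : ∀ h < H, Indep (MeasurableSpace.comap (noise h) inferInstance) (info h) P
  noise_mean : ∀ h < H, ∫ ω, noise h ω ∂P = 0
  noise_subgaussian : ∀ h < H, HasSubgaussianMGF (noise h) 1 P

section Play

variable {Ω : Type*} [MeasurableSpace Ω] {P : Measure Ω} {U b H : ℕ}

/-- The first `h` rounds when `π` is played, most recent round first; `param u` is the reward
parameter of user `u`, and pulling the arm `x` for user `u` gives `⟨x, param u⟩` plus noise. -/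
def Environment.history (E : Environment P U b H) (param : Fin U → Fin b → ℝ) (π : Policy U b)
    (ω : Ω) : ℕ → List (Round U b)
  | 0 => []
  | h + 1 =>
    let past := E.history param π ω h
    let u := E.user h ω
    let x := E.arm h (π past u (E.lastArm h) (fun k => E.arm h k ω)) ω
    ⟨u, x, x ⬝ᵥ param u + E.noise h ω⟩ :: past

/-- The arm pulled by `π` in round `h`. -/
def Environment.pulled (E : Environment P U b H) (param : Fin U → Fin b → ℝ) (π : Policy U b)
    (h : ℕ) (ω : Ω) : Fin b → ℝ :=
  E.arm h (π (E.history param π ω h) (E.user h ω) (E.lastArm h) (fun k => E.arm h k ω)) ω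

/-- The reward `X_h` that `π` receives in round `h`. -/
def Environment.reward (E : Environment P U b H) (param : Fin U → Fin b → ℝ) (π : Policy U b)
    (h : ℕ) (ω : Ω) : ℝ :=
  E.pulled param π h ω ⬝ᵥ param (E.user h ω) + E.noise h ω

/-- The best mean reward over the decision set of round `h`. -/
def Environment.best (E : Environment P U b H) (param : Fin U → Fin b → ℝ)
    (h : ℕ) (ω : Ω) : ℝ :=
  Finset.univ.sup' Finset.univ_nonempty (fun k => E.arm h k ω ⬝ᵥ param (E.user h ω))

/-- The regret of `π` over the `H` rounds before taking the expectation. -/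
def Environment.realizedRegret (E : Environment P U b H) (param : Fin U → Fin b → ℝ)
    (π : Policy U b) (ω : Ω) : ℝ :=
  ∑ h ∈ Finset.range H, (E.best param h ω - E.reward param π h ω)

end Play

/-- The first index at which a finite nonempty family is maximal. -/
def firstArgmax {k : ℕ} (f : Fin (k + 1) → ℝ) : Fin (k + 1) :=
  (Finset.univ.filter (fun i => ∀ j, f j ≤ f i)).min' (by
    obtain ⟨i, hi⟩ := Finite.exists_max f
    exact ⟨i, by simpa using hi⟩)

section ShiftedLinUCB

variable {U a b d : ℕ} (DT : Matrix (Fin b) (Fin a) ℝ) (DG : Matrix (Fin b) (Fin d) ℝ)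
  (source : Fin U → Fin a → ℝ)

/-- The past rounds of one user. -/
def roundsOf (past : List (Round U b)) (u : Fin U) : List (Round U b) :=
  past.filter (fun ρ => ρ.user = u)

/-- Regularized Gram matrix `I + ∑ z zᵀ` of the transformed arms `z = D_Gᵀ x` pulled for `u`. -/
def gram (past : List (Round U b)) (u : Fin U) : Matrix (Fin d) (Fin d) ℝ :=
  1 + ((roundsOf past u).map (fun ρ =>
    Matrix.vecMulVec (DG.transpose.mulVec ρ.arm) (DG.transpose.mulVec ρ.arm))).sum

/-- Ridge estimate of `ψᵘ` from the transformed arms `D_Gᵀ x` and the translated rewards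
`X - ⟨x, D_T A θᵘ⟩` of the past rounds of `u`; `source u` is the known vector `A θᵘ`. -/
def ridgeEstimate (past : List (Round U b)) (u : Fin U) : Fin d → ℝ :=
  (gram DG past u)⁻¹.mulVec ((roundsOf past u).map (fun ρ =>
    (ρ.reward - ρ.arm ⬝ᵥ DT.mulVec (source u)) • DG.transpose.mulVec ρ.arm)).sum

/-- Upper confidence bound for `⟨z, ψᵘ⟩`: the maximum of `⟨z, ψ⟩` over the confidence ellipsoid
`{ψ | (ψ - ψ̂)ᵀ V (ψ - ψ̂) ≤ radius²}` around the ridge estimate, where `V` is the Gram matrix and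
the radius depends on the dimension and the number of past rounds of the user. -/
def upperConfidence (radius : ℕ → ℕ → ℝ) (past : List (Round U b)) (u : Fin U)
    (z : Fin d → ℝ) : ℝ :=
  z ⬝ᵥ ridgeEstimate DT DG source past u +
    radius d (roundsOf past u).length * √(z ⬝ᵥ (gram DG past u)⁻¹.mulVec z)

/-- Shifted LinUCB: one bandit per user in `ℝᵈ`; an arm `x` maximizing
`⟨x, D_T A θᵘ⟩ + UCB(D_Gᵀ x)` is pulled. -/
def shiftedLinUCB (radius : ℕ → ℕ → ℝ) : Policy U b :=
  fun past u _ arms => firstArgmax (fun i =>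
    arms i ⬝ᵥ DT.mulVec (source u) +
      upperConfidence DT DG source radius past u (DG.transpose.mulVec (arms i)))

end ShiftedLinUCB

end SkylineBandit

end

/-! Linear algebra. Since `𝒰` has orthonormal columns, `π_Bᵀ π_B = I - π_Aᵀ π_A`, so `π_B` is
isometric on `Null(π_A)`. The rank of `π_A 𝒰` is `a`, which gives `d = r - a`; the row-space
dimension formula gives `r`. Splitting a vector into its part seen by `(π_A 𝒰)⁺` and its part in the
null space yields `Bθ = D_T Aθ + D_G ψ`. The range of `D_T` is orthogonal to that of `D_G`, hence `ψ
= D_Gᵀ Bθ` is unique and has norm at most `1`. What remains is one `d`-dimensional linear bandit per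
user with a known shift.

Regret of one round. Let `V` be the user's Gram matrix, `s = ∑ η z` and `t` the number of the user's
past rounds. If `sᵀ V⁻¹ s ≤ (d + 4) log (1 + t)`, optimism bounds the regret by twice the confidence
width (`Environment.gap_le_of_noiseSum_le`). Otherwise the mixture `M = exp (½ sᵀ V⁻¹ s) / √(det V)`
is at least `(1 + t)²`, while the regret is at most `2`, so `2 M / (1 + t)²` pays for it
(`Environment.gap_le`).

Failures. By the method of mixtures `M` does not grow in mean (`lintegral_growth_le`). The potential
`2 M / (t + 1)` therefore drops in mean by at least the charge `M / (1 + t)²` at each visit, so a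
user's charges total at most `2` (`Environment.sum_lintegral_mixture_le`). No confidence level or
union bound over time enters, and the radii need not know `H` or `U`.

Widths. On every path the elliptical potential bounds a user's squared widths by `2 d log (1 +
N_u)`, with `N_u` the final number of visits. Cauchy-Schwarz over all rounds, together with `∑ log²
(1 + N_u) ≤ 40 U log² (H / U)`, gives the order `d √(UH) log (H / U)`
(`Environment.sum_radius_mul_le`). -/

noncomputable section

namespace SkylineBandit

open Matrix

/-! ### Existence of the singular value decomposition and of orthonormal bases -/

/-- Every real matrix has a compact singular value decomposition. -/
theorem exists_compactSVD {m n : Type*} [Fintype m] [DecidableEq m] [Fintype n] [DecidableEq n]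
    (M : Matrix m n ℝ) :
    ∃ (r : ℕ) (L : Matrix m (Fin r) ℝ) (s : Fin r → ℝ) (R : Matrix n (Fin r) ℝ),
      Lᵀ * L = 1 ∧ Rᵀ * R = 1 ∧ (∀ i, 0 < s i) ∧ M = L * diagonal s * Rᵀ := by
  have hS : (M * Mᵀ).IsHermitian := by
    simpa using Matrix.isHermitian_mul_conjTranspose_self M
  have hpsd : (M * Mᵀ).PosSemidef := by
    simpa using Matrix.posSemidef_self_mul_conjTranspose M
  set W : Matrix m m ℝ := (hS.eigenvectorUnitary : Matrix m m ℝ) with hW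
  have hW1 : Wᵀ * W = 1 := by
    simpa [star_eq_conjTranspose] using Unitary.coe_star_mul_self hS.eigenvectorUnitary
  have hW2 : W * Wᵀ = 1 := by
    simpa [star_eq_conjTranspose] using Unitary.coe_mul_star_self hS.eigenvectorUnitary
  have hspec : M * Mᵀ = W * diagonal hS.eigenvalues * Wᵀ := by
    have h := hS.spectral_theorem
    rw [Unitary.conjStarAlgAut_apply] at h
    simpa [star_eq_conjTranspose, Function.comp_def] using h
  -- The rows of `Wᵀ M` are orthogonal with squared norms the eigenvalues of `M Mᵀ`. Dropping the
  -- zero rows and normalizing the others gives the right factor.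
  set N := Wᵀ * M with hN
  have hNN : N * Nᵀ = diagonal hS.eigenvalues := by
    calc N * Nᵀ = Wᵀ * (M * Mᵀ) * W := by
          rw [hN, transpose_mul, transpose_transpose]; simp only [Matrix.mul_assoc]
      _ = (Wᵀ * W) * diagonal hS.eigenvalues * (Wᵀ * W) := by
          have := congrArg (fun X => Wᵀ * X * W) hspec
          simpa only [Matrix.mul_assoc] using this
      _ = _ := by rw [hW1]; simp
  have hN0 : ∀ i, hS.eigenvalues i = 0 → ∀ j, N i j = 0 := by
    intro i hi j
    have h := congrFun (congrFun hNN i) i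
    rw [diagonal_apply_eq, hi, mul_apply] at h
    have := (Finset.sum_eq_zero_iff_of_nonneg (fun k _ => by
      simpa using mul_self_nonneg (N i k))).1 h j (Finset.mem_univ _)
    simpa using this
  have hMWN : M = W * N := by rw [hN, ← Matrix.mul_assoc, hW2, Matrix.one_mul]
  let eq := (Fintype.equivFin {i // hS.eigenvalues i ≠ 0}).symm
  set r := Fintype.card {i // hS.eigenvalues i ≠ 0}
  let e : Fin r → m := fun j => (eq j : m)
  have he : Function.Injective e := Subtype.val_injective.comp eq.injective
  have hpos : ∀ j, 0 < hS.eigenvalues (e j) := fun j =>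
    lt_of_le_of_ne (hpsd.eigenvalues_nonneg _) (Ne.symm (eq j).2)
  let s : Fin r → ℝ := fun j => √(hS.eigenvalues (e j))
  have hs : ∀ j, 0 < s j := fun j => Real.sqrt_pos.2 (hpos j)
  have hss : ∀ j, s j * s j = hS.eigenvalues (e j) := fun j => Real.mul_self_sqrt (hpos j).le
  let L : Matrix m (Fin r) ℝ := W.submatrix id e
  let K : Matrix (Fin r) n ℝ := N.submatrix e id
  have hKK : K * Kᵀ = diagonal (fun j => s j * s j) := by
    ext i j
    have h := congrFun (congrFun hNN (e i)) (e j)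
    have h2 : (K * Kᵀ) i j = (N * Nᵀ) (e i) (e j) := by simp [K, mul_apply]
    rw [h2, h]
    by_cases hij : i = j
    · subst hij; simp [hss]
    · rw [diagonal_apply_ne _ hij, diagonal_apply_ne _ (fun hh => hij (he hh))]
  have hLK : M = L * K := by
    ext x y
    rw [hMWN, mul_apply, mul_apply]
    have h1 : ∑ i, W x i * N i y = ∑ i : {i // hS.eigenvalues i ≠ 0}, W x i * N i y := by
      refine ((Finset.sum_filter_of_ne (p := fun i => hS.eigenvalues i ≠ 0) ?_).symm).trans
        (Finset.sum_subtype _ (by simp) _)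
      intro i _ hi h0
      exact hi (by rw [hN0 i h0 y, mul_zero])
    rw [h1, ← Equiv.sum_comp eq]
    rfl
  refine ⟨r, L, s, Kᵀ * diagonal (fun j => (s j)⁻¹), ?_, ?_, hs, ?_⟩
  · ext i j
    have h := congrFun (congrFun hW1 (e i)) (e j)
    have h2 : (Lᵀ * L) i j = (Wᵀ * W) (e i) (e j) := by simp [L, mul_apply]
    rw [h2, h, one_apply, one_apply]
    simp [he.eq_iff]
  · rw [transpose_mul, transpose_transpose, diagonal_transpose, Matrix.mul_assoc,
      ← Matrix.mul_assoc K, hKK, diagonal_mul_diagonal, diagonal_mul_diagonal, ← diagonal_one]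
    congr 1; ext j; have := (hs j).ne'; field_simp
  · rw [transpose_mul, transpose_transpose, diagonal_transpose, Matrix.mul_assoc,
      ← Matrix.mul_assoc (diagonal s), diagonal_mul_diagonal]
    have : (fun i => s i * (s i)⁻¹) = fun _ => 1 := by
      ext j; exact mul_inv_cancel₀ (hs j).ne'
    rw [this, diagonal_one, Matrix.one_mul, ← hLK]

/-- The sum of the dimensions of the row spaces. -/
theorem rank_fromRows_add {a b n : ℕ} (A : Matrix (Fin a) (Fin n) ℝ)
    (B : Matrix (Fin b) (Fin n) ℝ) :
    (fromRows A B).rank + Module.finrank ℝ (rowSpace A ⊓ rowSpace B : Submodule ℝ (Fin n → ℝ)) =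
      A.rank + B.rank := by
  rw [rank_eq_finrank_span_row A, rank_eq_finrank_span_row B, rank_eq_finrank_span_row]
  have : Set.range (fromRows A B).row = Set.range A.row ∪ Set.range B.row := by
    ext v; simp only [Set.mem_range, Set.mem_union, Sum.exists]; rfl
  rw [this, Submodule.span_union]
  exact Submodule.finrank_sup_add_finrank_inf_eq _ _

/-- The columns of some matrix form an orthonormal basis of a given subspace. -/
theorem exists_orthonormal_columns {b : ℕ} (S : Submodule ℝ (Fin b → ℝ)) :
    ∃ (d : ℕ) (G : Matrix (Fin b) (Fin d) ℝ), Gᵀ * G = 1 ∧ LinearMap.range G.mulVecLin = S := by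
  let S' : Submodule ℝ (EuclideanSpace ℝ (Fin b)) :=
    S.map (WithLp.linearEquiv 2 ℝ (Fin b → ℝ)).symm.toLinearMap
  let β := stdOrthonormalBasis ℝ S'
  refine ⟨Module.finrank ℝ S', Matrix.of fun i j => (β j : EuclideanSpace ℝ (Fin b)) i, ?_, ?_⟩
  · ext i j
    have h := orthonormal_iff_ite.1 β.orthonormal i j
    rw [Submodule.coe_inner, EuclideanSpace.inner_eq_star_dotProduct] at h
    rw [mul_apply, one_apply, ← h, dotProduct]
    exact Finset.sum_congr rfl fun k _ => mul_comm _ _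
  · have hcol : ∀ j, (Matrix.of fun i j => (β j : EuclideanSpace ℝ (Fin b)) i).col j =
        (WithLp.linearEquiv 2 ℝ (Fin b → ℝ)) (β j : EuclideanSpace ℝ (Fin b)) := fun j => rfl
    rw [range_mulVecLin]
    have h1 : Submodule.span ℝ (Set.range fun j => (β j : EuclideanSpace ℝ (Fin b))) = S' := by
      have := β.toBasis.span_eq
      have h2 := congrArg (Submodule.map S'.subtype) this
      rw [Submodule.map_span, Submodule.map_top, Submodule.range_subtype, ← Set.range_comp] at h2
      exact h2
    have h3 : Set.range (Matrix.of fun i j => (β j : EuclideanSpace ℝ (Fin b)) i).col =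
        (WithLp.linearEquiv 2 ℝ (Fin b → ℝ)).toLinearMap ''
          (Set.range fun j => (β j : EuclideanSpace ℝ (Fin b))) := by
      rw [← Set.range_comp]; rfl
    rw [h3, ← Submodule.map_span, h1]
    ext v
    simp [S']

/-! ### The decomposition into transformer and generator -/

section Decomposition

variable {a b n r d : ℕ} {A : Matrix (Fin a) (Fin n) ℝ} {B : Matrix (Fin b) (Fin n) ℝ}

/-- On the null space of the upper block the right side acts as the identity, so the lower block is
isometric there. -/
theorem toRows_gram {L : Matrix (Fin a ⊕ Fin b) (Fin r) ℝ} (h : Lᵀ * L = 1) :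
    L.toRows₂ᵀ * L.toRows₂ = 1 - L.toRows₁ᵀ * L.toRows₁ := by
  rw [← h]
  ext i j
  simp [mul_apply, Fintype.sum_sum_type]

theorem rank_svd {m n : Type*} [Fintype m] [DecidableEq m] [Fintype n] [DecidableEq n]
    {L : Matrix m (Fin r) ℝ} {s : Fin r → ℝ} {R : Matrix n (Fin r) ℝ}
    (hR : Rᵀ * R = 1) (hs : ∀ i, 0 < s i) : (L * diagonal s * Rᵀ).rank = L.rank := by
  apply le_antisymm
  · rw [Matrix.mul_assoc]; exact rank_mul_le_left _ _
  · have : L = L * diagonal s * Rᵀ * (R * diagonal fun i => (s i)⁻¹) := by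
      rw [Matrix.mul_assoc _ Rᵀ, ← Matrix.mul_assoc Rᵀ, hR, Matrix.one_mul, Matrix.mul_assoc,
        diagonal_mul_diagonal]
      have : (fun i => s i * (s i)⁻¹) = fun _ => 1 := by
        ext j; exact mul_inv_cancel₀ (hs j).ne'
      rw [this, diagonal_one, Matrix.mul_one]
    conv_lhs => rw [this]
    exact rank_mul_le_left _ _

theorem rank_of_gram_eq_one {m : Type*} [Fintype m] {L : Matrix m (Fin r) ℝ} (h : Lᵀ * L = 1) :
    L.rank = r := by
  rw [← rank_transpose_mul_self, h, rank_one, Fintype.card_fin]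

/-- With full row rank `M Mᵀ` is invertible, and the right inverse `Mᵀ (M Mᵀ)⁻¹` satisfies the
Penrose equations. -/
theorem exists_pseudoInverse {p q : ℕ} {M : Matrix (Fin p) (Fin q) ℝ} (h : M.rank = p) :
    ∃ P, IsPseudoInverse M P := by
  have hu : IsUnit (M * Mᵀ).det := by
    rw [← isUnit_iff_isUnit_det]
    have hr : (M * Mᵀ).rank = Fintype.card (Fin p) := by
      rw [rank_self_mul_transpose, h, Fintype.card_fin]
    rw [← mulVec_surjective_iff_isUnit]
    have := LinearMap.range_eq_top.1 (Submodule.eq_top_of_finrank_eq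
      (show Module.finrank ℝ (LinearMap.range (M * Mᵀ).mulVecLin) =
        Module.finrank ℝ (Fin p → ℝ) by rw [Module.finrank_fintype_fun_eq_card, ← hr]; rfl))
    exact this
  have h1 : M * (Mᵀ * (M * Mᵀ)⁻¹) = 1 := by rw [← Matrix.mul_assoc, mul_nonsing_inv _ hu]
  refine ⟨Mᵀ * (M * Mᵀ)⁻¹, ?_, ?_, ?_, ?_⟩
  · rw [h1, Matrix.one_mul]
  · rw [Matrix.mul_assoc, h1, Matrix.mul_one]
  · rw [h1, transpose_one]
  · rw [transpose_mul, transpose_mul, transpose_transpose, transpose_nonsing_inv, transpose_mul,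
      transpose_transpose, ← Matrix.mul_assoc]

theorem exists_decomposition (hA : A.rank = a) :
    ∃ r d : ℕ, Nonempty (Decomposition A B r d) := by
  obtain ⟨r, L, s, R, hL, hR, hs, hM⟩ := exists_compactSVD (fromRows A B)
  have hA' : A = L.toRows₁ * diagonal s * Rᵀ := by
    have := congrArg toRows₁ hM
    rw [toRows₁_fromRows] at this
    rw [this]; ext i j; simp [mul_apply]
  obtain ⟨Q, hQ⟩ := exists_pseudoInverse (M := L.toRows₁) (by
    rw [← rank_svd (L := L.toRows₁) hR hs, ← hA', hA])
  obtain ⟨d, G, hG, hG'⟩ := exists_orthonormal_columns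
    (Submodule.map L.toRows₂.mulVecLin (LinearMap.ker L.toRows₁.mulVecLin))
  exact ⟨r, d, ⟨⟨L, s, R, hL, hR, hs, hM, Q, hQ, G, hG, hG'⟩⟩⟩

variable (D : Decomposition A B r d)
include D

theorem Decomposition.source_eq : A = D.left.toRows₁ * diagonal D.sing * D.rightᵀ := by
  have := congrArg toRows₁ D.svd
  rw [toRows₁_fromRows] at this
  refine this.trans ?_
  ext i j; simp [mul_apply]

theorem Decomposition.target_eq : B = D.left.toRows₂ * diagonal D.sing * D.rightᵀ := by
  have := congrArg toRows₂ D.svd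
  rw [toRows₂_fromRows] at this
  refine this.trans ?_
  ext i j; simp [mul_apply]

theorem Decomposition.rank_add (hA : A.rank = a) (hB : B.rank = b) :
    r + Module.finrank ℝ (rowSpace A ⊓ rowSpace B : Submodule ℝ (Fin n → ℝ)) = a + b := by
  have h := rank_fromRows_add A B
  rwa [hA, hB, D.svd, rank_svd D.right_orthonormal D.sing_pos,
    rank_of_gram_eq_one D.left_orthonormal] at h

/-- Injectivity of the lower block on the null space of the upper one makes `d` the nullity of the
upper block, whose rank is that of `A`. Rank-nullity finishes. -/
theorem Decomposition.dim_add (hA : A.rank = a) : d + a = r := by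
  have h1 : Module.finrank ℝ (LinearMap.range D.generator.mulVecLin) = d :=
    rank_of_gram_eq_one D.generator_orthonormal
  have hdis : Disjoint (LinearMap.ker D.left.toRows₁.mulVecLin)
      (LinearMap.ker D.left.toRows₂.mulVecLin) := by
    rw [Submodule.disjoint_def]
    intro v h1 h2
    rw [LinearMap.mem_ker, mulVecLin_apply] at h1 h2
    have h := congrArg (fun M => M *ᵥ v) (toRows_gram D.left_orthonormal)
    simpa [sub_mulVec, ← mulVec_mulVec, h1, h2, eq_comm] using h
  rw [D.generator_range, ← LinearMap.range_domRestrict, LinearMap.finrank_range_of_inj] at h1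
  swap
  · exact LinearMap.injective_domRestrict_iff.2 hdis
  have h2 := LinearMap.finrank_range_add_finrank_ker D.left.toRows₁.mulVecLin
  have h3 : Module.finrank ℝ (LinearMap.range D.left.toRows₁.mulVecLin) = a := by
    change D.left.toRows₁.rank = a
    rw [← rank_svd (L := D.left.toRows₁) D.right_orthonormal D.sing_pos, ← D.source_eq, hA]
  rw [h1, h3] at h2
  simpa [add_comm] using h2

omit D in
theorem commonInformation_mul :
    commonInformation A B * b =
      Module.finrank ℝ (rowSpace A ⊓ rowSpace B : Submodule ℝ (Fin n → ℝ)) := by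
  unfold commonInformation
  rcases Nat.eq_zero_or_pos b with rfl | hb
  · have : (rowSpace B) = ⊥ := by
      rw [rowSpace, Set.range_eq_empty, Submodule.span_empty]
    rw [this, inf_bot_eq, finrank_bot]; simp
  · have : (b : ℝ) ≠ 0 := by positivity
    field_simp

/-- In the coordinates `y = Σ 𝒱ᵀ θ` the matrices `A` and `B` act as the two blocks of `𝒰`. The
residual `y - (π_A 𝒰)⁺ (π_A 𝒰) y` lies in the null space of `π_A 𝒰`, so its image under `π_B 𝒰` is
in the range of `D_G`. -/
theorem Decomposition.exists_param (θ : Fin n → ℝ) :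
    ∃ ψ : Fin d → ℝ, B *ᵥ θ = D.transformer *ᵥ (A *ᵥ θ) + D.generator *ᵥ ψ := by
  set y := (diagonal D.sing * D.rightᵀ) *ᵥ θ with hy
  have hA : A *ᵥ θ = D.left.toRows₁ *ᵥ y := by
    rw [hy, mulVec_mulVec, ← Matrix.mul_assoc, ← D.source_eq]
  have hB : B *ᵥ θ = D.left.toRows₂ *ᵥ y := by
    rw [hy, mulVec_mulVec, ← Matrix.mul_assoc, ← D.target_eq]
  have hmem : D.left.toRows₂ *ᵥ (y - D.pinv *ᵥ (D.left.toRows₁ *ᵥ y)) ∈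
      LinearMap.range D.generator.mulVecLin := by
    rw [D.generator_range]
    refine Submodule.mem_map_of_mem (f := D.left.toRows₂.mulVecLin) ?_
    rw [LinearMap.mem_ker, mulVecLin_apply, mulVec_sub, sub_eq_zero, mulVec_mulVec _ D.pinv,
      mulVec_mulVec _ D.left.toRows₁ (D.pinv * _), ← Matrix.mul_assoc, D.pinv_spec.mul_mul_self]
  obtain ⟨ψ, hψ⟩ := hmem
  refine ⟨ψ, ?_⟩
  rw [mulVecLin_apply] at hψ
  rw [hψ, hA, hB, Decomposition.transformer, mulVec_sub, ← mulVec_mulVec]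
  abel

/-- A column of `D_G` is `π_B 𝒰 v` with `π_A 𝒰 v = 0`, and `(π_B 𝒰)ᵀ` sends it back to `v`. The
range of the pseudo-inverse lies in that of `(π_A 𝒰)ᵀ`, hence is orthogonal to `v`. -/
theorem Decomposition.generator_transformer : D.generatorᵀ * D.transformer = 0 := by
  have hP : D.pinv = D.left.toRows₁ᵀ * (D.pinvᵀ * D.pinv) := by
    rw [← Matrix.mul_assoc, ← transpose_mul, D.pinv_spec.symm_right, D.pinv_spec.mul_self_mul]
  rw [← transpose_inj, transpose_mul, transpose_transpose, transpose_zero]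
  refine ext_of_mulVec_single fun j => ?_
  rw [← mulVec_mulVec, zero_mulVec]
  have hmem : D.generator *ᵥ Pi.single j 1 ∈ LinearMap.range D.generator.mulVecLin := ⟨_, rfl⟩
  rw [D.generator_range] at hmem
  obtain ⟨v, hv, hvj⟩ := hmem
  have hv' : D.left.toRows₁ *ᵥ v = 0 := hv
  rw [← hvj, mulVecLin_apply, Decomposition.transformer, transpose_mul, ← mulVec_mulVec,
    mulVec_mulVec _ D.left.toRows₂ᵀ, toRows_gram D.left_orthonormal, sub_mulVec, one_mulVec, ← mulVec_mulVec,
    hv', mulVec_zero, sub_zero]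
  rw [hP, transpose_mul, transpose_transpose, ← mulVec_mulVec, hv', mulVec_zero]

theorem Decomposition.param_eq {θ : Fin n → ℝ} {ψ : Fin d → ℝ}
    (h : B *ᵥ θ = D.transformer *ᵥ (A *ᵥ θ) + D.generator *ᵥ ψ) :
    ψ = D.generatorᵀ *ᵥ (B *ᵥ θ) := by
  rw [h, mulVec_add, mulVec_mulVec, D.generator_transformer, zero_mulVec, zero_add, mulVec_mulVec,
    D.generator_orthonormal, one_mulVec]

end Decomposition

theorem norm_toLp_sq {m : ℕ} (x : Fin m → ℝ) : ‖WithLp.toLp 2 x‖ ^ 2 = x ⬝ᵥ x := by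
  rw [EuclideanSpace.real_norm_sq_eq]; simp [dotProduct, sq]

/-- `G Gᵀ` is an orthogonal projection; the inequality is `0 ≤ ‖x - G Gᵀ x‖²` expanded. It keeps
transformed arms and `ψ` in the unit ball. -/
theorem dotProduct_transpose_mulVec_le {b d : ℕ} {G : Matrix (Fin b) (Fin d) ℝ} (hG : Gᵀ * G = 1)
    (x : Fin b → ℝ) : (Gᵀ *ᵥ x) ⬝ᵥ (Gᵀ *ᵥ x) ≤ x ⬝ᵥ x := by
  have h1 : (G *ᵥ (Gᵀ *ᵥ x)) ⬝ᵥ x = (Gᵀ *ᵥ x) ⬝ᵥ (Gᵀ *ᵥ x) := by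
    rw [dotProduct_comm, dotProduct_mulVec, ← mulVec_transpose]
  have h2 : (G *ᵥ (Gᵀ *ᵥ x)) ⬝ᵥ (G *ᵥ (Gᵀ *ᵥ x)) = (Gᵀ *ᵥ x) ⬝ᵥ (Gᵀ *ᵥ x) := by
    rw [dotProduct_mulVec, ← mulVec_transpose, mulVec_mulVec _ Gᵀ G, hG, one_mulVec]
  have h3 : 0 ≤ (x - G *ᵥ (Gᵀ *ᵥ x)) ⬝ᵥ (x - G *ᵥ (Gᵀ *ᵥ x)) := by
    simpa using dotProduct_star_self_nonneg (x - G *ᵥ (Gᵀ *ᵥ x))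
  rw [sub_dotProduct, dotProduct_sub, dotProduct_sub, h2, dotProduct_comm x (G *ᵥ _), h1] at h3
  linarith

/-! ### Method of mixtures for one subgaussian step -/

/-- Completing the square for the Gaussian density with mean `q / (1 + w)` and variance
`w / (1 + w)`. -/
theorem gaussianPDF_mul_exp (q : ℝ) {w : ℝ} (hw : 0 < w) (x : ℝ) :
    gaussianPDF (q / (1 + w)) (w / (1 + w)).toNNReal x * ENNReal.ofReal (Real.exp (x ^ 2 / 2)) =
      ENNReal.ofReal (√(1 + w) * Real.exp (q ^ 2 / (2 * (1 + w)))) *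
        gaussianPDF q w.toNNReal x := by
  have h1 : 0 < 1 + w := by linarith
  have hs : √(1 + w) ≠ 0 := (Real.sqrt_pos.2 h1).ne'
  rw [gaussianPDF, gaussianPDF, ← ENNReal.ofReal_mul (gaussianPDFReal_nonneg _ _ _),
    ← ENNReal.ofReal_mul (by positivity)]
  congr 1
  rw [gaussianPDFReal, gaussianPDFReal, Real.coe_toNNReal _ (by positivity),
    Real.coe_toNNReal _ hw.le, mul_assoc, ← Real.exp_add, mul_mul_mul_comm, ← Real.exp_add]
  congr 1
  · rw [show 2 * Real.pi * (w / (1 + w)) = 2 * Real.pi * w / (1 + w) by ring,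
      Real.sqrt_div (by positivity)]
    field_simp
  · congr 1
    field_simp
    ring

/-- The integral is finite because the variance `w / (1 + w)` is below `1`; completing the square
turns the integrand into a multiple of another Gaussian density. -/
theorem lintegral_exp_sq_gaussianReal (q : ℝ) {w : ℝ} (hw : 0 < w) :
    ∫⁻ x, ENNReal.ofReal (Real.exp (x ^ 2 / 2))
      ∂(gaussianReal (q / (1 + w)) (w / (1 + w)).toNNReal) =
      ENNReal.ofReal (√(1 + w) * Real.exp (q ^ 2 / (2 * (1 + w)))) := by
  have h1 : 0 < 1 + w := by linarith
  have hv : (w / (1 + w)).toNNReal ≠ 0 := by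
    rw [Ne, Real.toNNReal_eq_zero, not_le]; positivity
  rw [gaussianReal_of_var_ne_zero _ hv, lintegral_withDensity_eq_lintegral_mul _
    (measurable_gaussianPDF _ _) (by fun_prop)]
  simp only [Pi.mul_apply, gaussianPDF_mul_exp q hw]
  rw [lintegral_const_mul _ (measurable_gaussianPDF _ _), lintegral_gaussianPDF_eq_one, mul_one]
  rw [Ne, Real.toNNReal_eq_zero, not_le]; exact hw

theorem lintegral_exp_mul_gaussianReal (m : ℝ) (v : NNReal) (t : ℝ) :
    ∫⁻ x, ENNReal.ofReal (Real.exp (t * x)) ∂(gaussianReal m v) =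
      ENNReal.ofReal (Real.exp (m * t + v * t ^ 2 / 2)) := by
  rw [← ofReal_integral_eq_lintegral_ofReal (integrable_exp_mul_gaussianReal t)
    (Filter.Eventually.of_forall fun _ => (Real.exp_pos _).le)]
  congr 1
  exact congrFun (mgf_id_gaussianReal (μ := m) (v := v)) t

theorem lintegral_exp_mul_le {Ω : Type*} [MeasurableSpace Ω] {P : Measure Ω} {X : Ω → ℝ}
    (hX : HasSubgaussianMGF X 1 P) (t : ℝ) :
    ∫⁻ ω, ENNReal.ofReal (Real.exp (t * X ω)) ∂P ≤ ENNReal.ofReal (Real.exp (t ^ 2 / 2)) := by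
  rw [← ofReal_integral_eq_lintegral_ofReal (hX.integrable_exp_mul t)
    (Filter.Eventually.of_forall fun _ => (Real.exp_pos _).le)]
  apply ENNReal.ofReal_le_ofReal
  simpa [mgf] using hX.mgf_le t

/-- The factor by which `exp (½ sᵀ V⁻¹ s) / √(det V)` grows when `z zᵀ` is added to `V` and `η z`
to `s`, where `q = zᵀ V⁻¹ s` and `w = zᵀ V⁻¹ z`. -/
def growth (q w η : ℝ) : ℝ :=
  Real.exp ((-q ^ 2 + 2 * η * q + η ^ 2 * w) / (2 * (1 + w))) / √(1 + w)

theorem growth_nonneg (q w η : ℝ) : 0 ≤ growth q w η := by unfold growth; positivity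

theorem measurable_growth : Measurable fun p : ℝ × ℝ × ℝ => growth p.1 p.2.1 p.2.2 := by
  unfold growth; fun_prop

/-- The growth factor of a subgaussian step has mean at most one (method of mixtures). -/
theorem lintegral_growth_le {Ω : Type*} [MeasurableSpace Ω] {P : Measure Ω} [IsProbabilityMeasure P]
    {X : Ω → ℝ} (hX : HasSubgaussianMGF X 1 P) (hXm : Measurable X) (q : ℝ) {w : ℝ} (hw : 0 ≤ w) :
    ∫⁻ ω, ENNReal.ofReal (growth q w (X ω)) ∂P ≤ 1 := by
  have h1 : 0 < 1 + w := by linarith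
  have hs : 0 < √(1 + w) := Real.sqrt_pos.2 h1
  have hone : (1 : ENNReal) = ENNReal.ofReal (Real.exp (-(q ^ 2 / (2 * (1 + w)))) / √(1 + w)) *
      ENNReal.ofReal (√(1 + w) * Real.exp (q ^ 2 / (2 * (1 + w)))) := by
    rw [← ENNReal.ofReal_mul (by positivity), Real.exp_neg]
    field_simp
    simp
  have hg : ∀ ω, ENNReal.ofReal (growth q w (X ω)) =
      ENNReal.ofReal (Real.exp (-(q ^ 2 / (2 * (1 + w)))) / √(1 + w)) *
        ENNReal.ofReal (Real.exp ((2 * X ω * q + X ω ^ 2 * w) / (2 * (1 + w)))) := by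
    intro ω
    rw [← ENNReal.ofReal_mul (by positivity), growth, div_mul_eq_mul_div, ← Real.exp_add]
    congr 4
    ring
  simp only [hg]
  rw [lintegral_const_mul _ (by fun_prop)]
  conv_rhs => rw [hone]
  gcongr
  -- For `w = 0` the exponent is linear in the noise and the subgaussian bound applies directly. For
  -- `w > 0` the exponential of a quadratic in the noise is written as a Gaussian average of
  -- exponentials of linear functions, and Tonelli lets the subgaussian bound act inside.
  rcases hw.eq_or_lt with rfl | hw
  · refine le_trans (le_of_eq ?_) ((lintegral_exp_mul_le hX q).trans (le_of_eq ?_))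
    · congr 1; ext ω; congr 2; ring
    · simp
  · rw [← lintegral_exp_sq_gaussianReal q hw]
    calc _ = ∫⁻ ω, ∫⁻ x, ENNReal.ofReal (Real.exp (X ω * x))
          ∂(gaussianReal (q / (1 + w)) (w / (1 + w)).toNNReal) ∂P := by
          congr 1; ext ω
          rw [lintegral_exp_mul_gaussianReal, Real.coe_toNNReal _ (by positivity)]
          congr 2; field_simp
      _ = ∫⁻ x, ∫⁻ ω, ENNReal.ofReal (Real.exp (X ω * x)) ∂P
          ∂(gaussianReal (q / (1 + w)) (w / (1 + w)).toNNReal) := by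
          refine lintegral_lintegral_swap (Measurable.aemeasurable ?_)
          unfold Function.uncurry; fun_prop
      _ ≤ _ := by
          refine lintegral_mono fun x => ?_
          simpa only [mul_comm] using lintegral_exp_mul_le hX x

/-- A nonnegative weight known before an independent subgaussian step does not grow in mean. -/
theorem lintegral_mul_growth_le {Ω : Type*} {m mΩ : MeasurableSpace Ω} {P : Measure Ω}
    [IsProbabilityMeasure P] (hm : m ≤ mΩ) {X : Ω → ℝ}
    (hX : HasSubgaussianMGF X 1 P) (hXm : Measurable X)
    (hind : Indep (MeasurableSpace.comap X inferInstance) m P)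
    {c : Ω → ENNReal} {q w : Ω → ℝ} (hc : Measurable[m] c) (hq : Measurable[m] q)
    (hw : Measurable[m] w) (hw0 : ∀ ω, 0 ≤ w ω) :
    ∫⁻ ω, c ω * ENNReal.ofReal (growth (q ω) (w ω) (X ω)) ∂P ≤ ∫⁻ ω, c ω ∂P := by
  let Y : Ω → ENNReal × ℝ × ℝ := fun ω => (c ω, q ω, w ω)
  have hY : Measurable[m] Y := hc.prodMk (hq.prodMk hw)
  have hY' : Measurable Y := hY.mono hm le_rfl
  have hYX : IndepFun Y X P := by
    rw [IndepFun_iff_Indep]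
    exact (indep_of_indep_of_le_right hind hY.comap_le).symm
  let F : (ENNReal × ℝ × ℝ) × ℝ → ENNReal := fun p =>
    p.1.1 * ENNReal.ofReal (growth p.1.2.1 p.1.2.2 p.2)
  have hF : Measurable F := by
    refine (measurable_fst.comp measurable_fst).mul (ENNReal.measurable_ofReal.comp ?_)
    exact measurable_growth.comp (f := fun p : (ENNReal × ℝ × ℝ) × ℝ => (p.1.2.1, p.1.2.2, p.2))
      (by fun_prop)
  calc ∫⁻ ω, c ω * ENNReal.ofReal (growth (q ω) (w ω) (X ω)) ∂P
      = ∫⁻ p, F p ∂(P.map fun ω => (Y ω, X ω)) := by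
        rw [lintegral_map hF (hY'.prodMk hXm)]
    _ = ∫⁻ y, ∫⁻ x, F (y, x) ∂(P.map X) ∂(P.map Y) := by
        have := Measure.isProbabilityMeasure_map hXm.aemeasurable (μ := P)
        rw [(indepFun_iff_map_prod_eq_prod_map_map hY'.aemeasurable hXm.aemeasurable).1 hYX,
          lintegral_prod _ hF.aemeasurable]
    _ = ∫⁻ ω, ∫⁻ x, F (Y ω, x) ∂(P.map X) ∂P := by
        have := Measure.isProbabilityMeasure_map hXm.aemeasurable (μ := P)
        rw [lintegral_map hF.lintegral_prod_right' hY']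
    _ ≤ _ := by
        refine lintegral_mono fun ω => ?_
        have hFω : Measurable fun x => ENNReal.ofReal (growth (q ω) (w ω) x) :=
          ENNReal.measurable_ofReal.comp (measurable_growth.comp
            (f := fun x : ℝ => (q ω, w ω, x)) (by fun_prop))
        change ∫⁻ x, c ω * ENNReal.ofReal (growth (q ω) (w ω) x) ∂(P.map X) ≤ c ω
        rw [lintegral_const_mul _ hFω, lintegral_map hFω hXm]
        exact mul_le_of_le_one_right' (lintegral_growth_le hX hXm (q ω) (hw0 ω))

/-! ### Ridge matrices and their rank-one updates -/

/-- `V` is symmetric and lies between `I` and `(1 + t) I`, as do the Gram matrices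
`I + ∑ z zᵀ` of `t` vectors of the unit ball. -/
structure IsRidge {d : ℕ} (V : Matrix (Fin d) (Fin d) ℝ) (t : ℕ) : Prop where
  isHermitian : V.IsHermitian
  lower : ∀ x, x ⬝ᵥ x ≤ x ⬝ᵥ V *ᵥ x
  upper : ∀ x, x ⬝ᵥ V *ᵥ x ≤ (1 + t) * (x ⬝ᵥ x)

theorem zero_le_dotProduct_self {m : Type*} [Fintype m] (x : m → ℝ) : 0 ≤ x ⬝ᵥ x := by
  simpa using dotProduct_star_self_nonneg x

theorem dotProduct_sq_le {m : Type*} [Fintype m] (x y : m → ℝ) :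
    (x ⬝ᵥ y) ^ 2 ≤ (x ⬝ᵥ x) * (y ⬝ᵥ y) := by
  have := Finset.sum_mul_sq_le_sq_mul_sq Finset.univ x y
  simpa only [dotProduct, sq] using this

namespace IsRidge

variable {d t : ℕ} {V : Matrix (Fin d) (Fin d) ℝ}

theorem one : IsRidge (1 : Matrix (Fin d) (Fin d) ℝ) 0 :=
  ⟨isHermitian_one, fun x => by simp, fun x => by simp⟩

theorem add_vecMulVec (hV : IsRidge V t) {z : Fin d → ℝ} (hz : z ⬝ᵥ z ≤ 1) :
    IsRidge (V + vecMulVec z z) (t + 1) := by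
  have key : ∀ x, x ⬝ᵥ (V + vecMulVec z z) *ᵥ x = x ⬝ᵥ V *ᵥ x + (x ⬝ᵥ z) ^ 2 := by
    intro x
    rw [add_mulVec, dotProduct_add, vecMulVec_mulVec, op_smul_eq_smul, dotProduct_smul,
      smul_eq_mul, dotProduct_comm z x, sq]
  refine ⟨hV.isHermitian.add ?_, fun x => ?_, fun x => ?_⟩
  · simpa using (posSemidef_vecMulVec_self_star z).isHermitian
  · rw [key]; nlinarith [hV.lower x, sq_nonneg (x ⬝ᵥ z)]
  · rw [key]
    have h1 := hV.upper x
    have h2 := dotProduct_sq_le x z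
    have h3 := mul_le_of_le_one_right (zero_le_dotProduct_self x) hz
    push_cast
    linarith

theorem posDef (hV : IsRidge V t) : V.PosDef := by
  refine PosDef.of_dotProduct_mulVec_pos hV.isHermitian fun x hx => ?_
  refine lt_of_lt_of_le ?_ (hV.lower x)
  simpa using dotProduct_star_self_pos_iff.2 hx

theorem det_pos (hV : IsRidge V t) : 0 < V.det := hV.posDef.det_pos

theorem isUnit_det (hV : IsRidge V t) : IsUnit V.det := hV.det_pos.ne'.isUnit

theorem mul_inv_mulVec (hV : IsRidge V t) (x : Fin d → ℝ) : V *ᵥ (V⁻¹ *ᵥ x) = x := by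
  rw [mulVec_mulVec, mul_nonsing_inv _ hV.isUnit_det, one_mulVec]

theorem inv_mul_mulVec (hV : IsRidge V t) (x : Fin d → ℝ) : V⁻¹ *ᵥ (V *ᵥ x) = x := by
  rw [mulVec_mulVec, nonsing_inv_mul _ hV.isUnit_det, one_mulVec]

theorem dotProduct_comm_mulVec (hV : IsRidge V t) (x y : Fin d → ℝ) :
    x ⬝ᵥ V *ᵥ y = y ⬝ᵥ V *ᵥ x := by
  have : Vᵀ = V := (show V.IsSymm by simpa using hV.isHermitian)
  rw [dotProduct_mulVec, ← mulVec_transpose, this, dotProduct_comm]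

theorem dotProduct_comm_inv (hV : IsRidge V t) (x y : Fin d → ℝ) :
    x ⬝ᵥ V⁻¹ *ᵥ y = y ⬝ᵥ V⁻¹ *ᵥ x := by
  conv_lhs => rw [← hV.mul_inv_mulVec x]
  rw [dotProduct_comm, hV.dotProduct_comm_mulVec, hV.mul_inv_mulVec, dotProduct_comm]

/-- Each eigenvalue is the quadratic form at a unit eigenvector, hence at most `1 + t`. -/
theorem det_le (hV : IsRidge V t) : V.det ≤ (1 + t : ℝ) ^ d := by
  rw [hV.isHermitian.det_eq_prod_eigenvalues]
  calc ∏ i, (hV.isHermitian.eigenvalues i : ℝ) ≤ ∏ _i : Fin d, (1 + t : ℝ) := by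
        refine Finset.prod_le_prod (fun i _ => (hV.posDef.eigenvalues_pos i).le) fun i _ => ?_
        have h := hV.isHermitian.eigenvalues_eq i
        have h1 := norm_toLp_sq (hV.isHermitian.eigenvectorBasis i).ofLp
        rw [WithLp.toLp_ofLp, hV.isHermitian.eigenvectorBasis.orthonormal.1 i] at h1
        have h2 := hV.upper (hV.isHermitian.eigenvectorBasis i).ofLp
        rw [← h1] at h2
        simp at h h2
        rw [h]; exact h2
    _ = _ := by simp

theorem log_det_le (hV : IsRidge V t) : Real.log V.det ≤ d * Real.log (1 + t) := by
  rw [← Real.log_pow]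
  exact Real.log_le_log hV.det_pos hV.det_le

theorem inv_nonneg (hV : IsRidge V t) (x : Fin d → ℝ) : 0 ≤ x ⬝ᵥ V⁻¹ *ᵥ x := by
  simpa using hV.posDef.inv.posSemidef.dotProduct_mulVec_nonneg x

theorem inv_le (hV : IsRidge V t) (x : Fin d → ℝ) : x ⬝ᵥ V⁻¹ *ᵥ x ≤ x ⬝ᵥ x := by
  have h1 := hV.lower (V⁻¹ *ᵥ x)
  rw [hV.mul_inv_mulVec, dotProduct_comm _ x] at h1
  have h2 := dotProduct_sq_le x (V⁻¹ *ᵥ x)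
  have h3 := hV.inv_nonneg x
  have h4 := zero_le_dotProduct_self x
  rcases h3.eq_or_lt with h | h
  · rw [← h]; exact h4
  · nlinarith

theorem inv_sq_le (hV : IsRidge V t) (x y : Fin d → ℝ) :
    (x ⬝ᵥ V⁻¹ *ᵥ y) ^ 2 ≤ (x ⬝ᵥ V⁻¹ *ᵥ x) * (y ⬝ᵥ V⁻¹ *ᵥ y) := by
  have h : ∀ c : ℝ, 0 ≤ (y ⬝ᵥ V⁻¹ *ᵥ y) * (c * c) + 2 * (x ⬝ᵥ V⁻¹ *ᵥ y) * c + x ⬝ᵥ V⁻¹ *ᵥ x := by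
    intro c
    refine (hV.inv_nonneg (x + c • y)).trans_eq ?_
    rw [mulVec_add, mulVec_smul, add_dotProduct, dotProduct_add, dotProduct_add, smul_dotProduct,
      smul_dotProduct, dotProduct_smul, dotProduct_smul, hV.dotProduct_comm_inv y x]
    simp only [smul_eq_mul]; ring
  have := discrim_le_zero h
  rw [discrim] at this
  nlinarith

theorem abs_dotProduct_inv_le (hV : IsRidge V t) (x y : Fin d → ℝ) :
    |x ⬝ᵥ V⁻¹ *ᵥ y| ≤ √(x ⬝ᵥ V⁻¹ *ᵥ x) * √(y ⬝ᵥ V⁻¹ *ᵥ y) := by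
  rw [← Real.sqrt_mul (hV.inv_nonneg x)]
  exact Real.abs_le_sqrt (hV.inv_sq_le x y)

/-- Sherman-Morrison formula, checked by applying `V + z zᵀ` to the right side. -/
theorem inv_add_vecMulVec_mulVec (hV : IsRidge V t) {z : Fin d → ℝ} (hz : z ⬝ᵥ z ≤ 1)
    (y : Fin d → ℝ) :
    (V + vecMulVec z z)⁻¹ *ᵥ y =
      V⁻¹ *ᵥ y - ((z ⬝ᵥ V⁻¹ *ᵥ y) / (1 + z ⬝ᵥ V⁻¹ *ᵥ z)) • V⁻¹ *ᵥ z := by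
  have h := hV.inv_nonneg z
  have h1 : 1 + z ⬝ᵥ V⁻¹ *ᵥ z ≠ 0 := by positivity
  conv_rhs => rw [← (hV.add_vecMulVec hz).inv_mul_mulVec (V⁻¹ *ᵥ y - _)]
  congr 1
  rw [add_mulVec, mulVec_sub, mulVec_smul, hV.mul_inv_mulVec, hV.mul_inv_mulVec, vecMulVec_mulVec,
    op_smul_eq_smul, dotProduct_sub, dotProduct_smul, smul_eq_mul]
  ext i
  simp only [Pi.add_apply, Pi.sub_apply, Pi.smul_apply, smul_eq_mul]
  field_simp
  ring

theorem det_add_vecMulVec (hV : IsRidge V t) (z : Fin d → ℝ) :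
    (V + vecMulVec z z).det = V.det * (1 + z ⬝ᵥ V⁻¹ *ᵥ z) := by
  rw [vecMulVec_eq Unit, det_add_replicateCol_mul_replicateRow hV.isUnit_det, Matrix.mul_assoc,
    ← replicateCol_mulVec, det_unique (n := Unit)]
  congr 1

end IsRidge

/-! ### Mixture martingale, elliptical potential and confidence width -/

/-- The mixture martingale `exp (½ sᵀ V⁻¹ s) / √(det V)`. -/
def mixture {d : ℕ} (V : Matrix (Fin d) (Fin d) ℝ) (s : Fin d → ℝ) : ℝ :=
  Real.exp ((s ⬝ᵥ V⁻¹ *ᵥ s) / 2) / √V.det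

theorem mixture_nonneg {d : ℕ} (V : Matrix (Fin d) (Fin d) ℝ) (s : Fin d → ℝ) :
    0 ≤ mixture V s := by unfold mixture; positivity

theorem mixture_one_zero {d : ℕ} : mixture (1 : Matrix (Fin d) (Fin d) ℝ) 0 = 1 := by
  simp [mixture]

theorem IsRidge.mixture_add {d t : ℕ} {V : Matrix (Fin d) (Fin d) ℝ} (hV : IsRidge V t)
    {z : Fin d → ℝ} (hz : z ⬝ᵥ z ≤ 1) (s : Fin d → ℝ) (η : ℝ) :
    mixture (V + vecMulVec z z) (s + η • z) =
      mixture V s * growth (z ⬝ᵥ V⁻¹ *ᵥ s) (z ⬝ᵥ V⁻¹ *ᵥ z) η := by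
  have h := hV.inv_nonneg z
  have h1 : 1 + z ⬝ᵥ V⁻¹ *ᵥ z ≠ 0 := by positivity
  rw [mixture, mixture, growth, hV.det_add_vecMulVec, Real.sqrt_mul hV.det_pos.le,
    div_mul_div_comm, ← Real.exp_add, hV.inv_add_vecMulVec_mulVec hz]
  congr 2
  simp only [mulVec_add, mulVec_smul, dotProduct_sub, dotProduct_add, add_dotProduct,
    dotProduct_smul, smul_dotProduct, hV.dotProduct_comm_inv s z, smul_eq_mul]
  field_simp
  ring

/-- Where the normalized noise exceeds its confidence radius, the mixture martingale is large. -/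
theorem IsRidge.sq_le_mixture {d t : ℕ} {V : Matrix (Fin d) (Fin d) ℝ} (hV : IsRidge V t)
    {s : Fin d → ℝ} (hs : (d + 4) * Real.log (1 + t) ≤ s ⬝ᵥ V⁻¹ *ᵥ s) :
    (1 + t : ℝ) ^ 2 ≤ mixture V s := by
  have hdet := hV.det_pos
  rw [← Real.log_le_log_iff (by positivity) (by unfold mixture; positivity), mixture,
    Real.log_div (Real.exp_pos _).ne' (Real.sqrt_pos.2 hdet).ne', Real.log_exp, Real.log_pow,
    Real.log_sqrt hdet.le]
  -- Of the `d + 4` in the hypothesis, `d` cancels the determinant and half of the remaining `4` is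
  -- the exponent `2`.
  have := hV.log_det_le
  push_cast
  linarith

/-- Follows from `log y ≥ 1 - 1 / y`; the restriction `w ≤ 1` is met because `V ≥ I` and the
transformed arms have norm at most `1`. -/
theorem le_two_mul_log_one_add {w : ℝ} (h0 : 0 ≤ w) (h1 : w ≤ 1) : w ≤ 2 * Real.log (1 + w) := by
  have h := Real.one_sub_inv_le_log_of_pos (show 0 < 1 + w by linarith)
  have : w / 2 ≤ 1 - (1 + w)⁻¹ := by
    rw [← sub_nonneg]
    have : 1 - (1 + w)⁻¹ - w / 2 = w * (1 - w) / (2 * (1 + w)) := by field_simp; ring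
    rw [this]
    exact div_nonneg (mul_nonneg h0 (by linarith)) (by linarith)
  linarith

/-- One step of the elliptical potential. -/
theorem IsRidge.le_log_det_sub {d t : ℕ} {V : Matrix (Fin d) (Fin d) ℝ} (hV : IsRidge V t)
    {z : Fin d → ℝ} (hz : z ⬝ᵥ z ≤ 1) :
    z ⬝ᵥ V⁻¹ *ᵥ z ≤ 2 * (Real.log (V + vecMulVec z z).det - Real.log V.det) := by
  have h := hV.inv_nonneg z
  rw [hV.det_add_vecMulVec, Real.log_mul hV.det_pos.ne' (by positivity), add_sub_cancel_left]
  exact le_two_mul_log_one_add h ((hV.inv_le z).trans hz)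

/-- Width of the confidence ellipsoid: if `sᵀ V⁻¹ s ≤ c` and `‖ψ‖ ≤ 1`, the estimation error
`V⁻¹ (s - ψ)` in direction `z` is at most `(1 + √c) √(zᵀ V⁻¹ z)`. -/
theorem IsRidge.abs_error_le {d t : ℕ} {V : Matrix (Fin d) (Fin d) ℝ} (hV : IsRidge V t)
    {s ψ : Fin d → ℝ} {c : ℝ} (hs : s ⬝ᵥ V⁻¹ *ᵥ s ≤ c) (hψ : ψ ⬝ᵥ ψ ≤ 1) (z : Fin d → ℝ) :
    |z ⬝ᵥ V⁻¹ *ᵥ (s - ψ)| ≤ (1 + √c) * √(z ⬝ᵥ V⁻¹ *ᵥ z) := by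
  rw [mulVec_sub, dotProduct_sub]
  have h1 := hV.abs_dotProduct_inv_le z s
  have h2 := hV.abs_dotProduct_inv_le z ψ
  have h3 : √(s ⬝ᵥ V⁻¹ *ᵥ s) ≤ √c := Real.sqrt_le_sqrt hs
  have h4 : √(ψ ⬝ᵥ V⁻¹ *ᵥ ψ) ≤ 1 := Real.sqrt_le_one.2 ((hV.inv_le ψ).trans hψ)
  have h5 := Real.sqrt_nonneg (z ⬝ᵥ V⁻¹ *ᵥ z)
  have h6 := abs_sub (z ⬝ᵥ V⁻¹ *ᵥ s) (z ⬝ᵥ V⁻¹ *ᵥ ψ)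
  nlinarith [mul_le_mul_of_nonneg_left h3 h5, mul_le_mul_of_nonneg_left h4 h5]

/-! ### Recursions for the statistics of one user -/

section Statistics

variable {U a b d : ℕ} (DT : Matrix (Fin b) (Fin a) ℝ) (DG : Matrix (Fin b) (Fin d) ℝ)
  (source : Fin U → Fin a → ℝ) (ψ : Fin U → Fin d → ℝ)

/-- The vector `∑ (X - ⟨x, D_T A θᵘ⟩) z` of the ridge regression of a user. -/
def shiftedSum (past : List (Round U b)) (u : Fin U) : Fin d → ℝ :=
  ((roundsOf past u).map (fun ρ =>
    (ρ.reward - ρ.arm ⬝ᵥ DT *ᵥ source u) • DGᵀ *ᵥ ρ.arm)).sum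

/-- The part `∑ η z` of `shiftedSum` that is due to the noise, when `ψ u` is the true parameter. -/
def noiseSum (past : List (Round U b)) (u : Fin U) : Fin d → ℝ :=
  shiftedSum DT DG source past u - (gram DG past u - 1) *ᵥ ψ u

theorem ridgeEstimate_eq (past : List (Round U b)) (u : Fin U) :
    ridgeEstimate DT DG source past u = (gram DG past u)⁻¹ *ᵥ shiftedSum DT DG source past u :=
  rfl

theorem roundsOf_cons (ρ : Round U b) (past : List (Round U b)) (u : Fin U) :
    roundsOf (ρ :: past) u = if ρ.user = u then ρ :: roundsOf past u else roundsOf past u := by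
  simp [roundsOf, List.filter_cons]

theorem count_cons (ρ : Round U b) (past : List (Round U b)) (u : Fin U) :
    (roundsOf (ρ :: past) u).length =
      if ρ.user = u then (roundsOf past u).length + 1 else (roundsOf past u).length := by
  rw [roundsOf_cons]; split_ifs <;> rfl

theorem gram_cons (ρ : Round U b) (past : List (Round U b)) (u : Fin U) :
    gram DG (ρ :: past) u = if ρ.user = u then
      gram DG past u + vecMulVec (DGᵀ *ᵥ ρ.arm) (DGᵀ *ᵥ ρ.arm) else gram DG past u := by
  rw [gram, roundsOf_cons]
  split_ifs
  · rw [List.map_cons, List.sum_cons, gram]; abel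
  · rfl

theorem shiftedSum_cons (ρ : Round U b) (past : List (Round U b)) (u : Fin U) :
    shiftedSum DT DG source (ρ :: past) u = if ρ.user = u then
      shiftedSum DT DG source past u + (ρ.reward - ρ.arm ⬝ᵥ DT *ᵥ source u) • DGᵀ *ᵥ ρ.arm
      else shiftedSum DT DG source past u := by
  rw [shiftedSum, roundsOf_cons]
  split_ifs
  · rw [List.map_cons, List.sum_cons, shiftedSum]; abel
  · rfl

theorem noiseSum_cons (ρ : Round U b) (past : List (Round U b)) (u : Fin U) :
    noiseSum DT DG source ψ (ρ :: past) u = if ρ.user = u then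
      noiseSum DT DG source ψ past u +
        (ρ.reward - ρ.arm ⬝ᵥ DT *ᵥ source u - (DGᵀ *ᵥ ρ.arm) ⬝ᵥ ψ u) • DGᵀ *ᵥ ρ.arm
      else noiseSum DT DG source ψ past u := by
  rw [noiseSum, gram_cons, shiftedSum_cons]
  split_ifs
  · rw [noiseSum, add_sub_right_comm (gram DG past u), add_mulVec, vecMulVec_mulVec, op_smul_eq_smul,
      sub_smul _ ((DGᵀ *ᵥ ρ.arm) ⬝ᵥ ψ u)]
    abel
  · rfl

@[simp] theorem gram_nil (u : Fin U) : gram DG ([] : List (Round U b)) u = 1 := by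
  simp [gram, roundsOf]

@[simp] theorem shiftedSum_nil (u : Fin U) : shiftedSum DT DG source [] u = 0 := by
  simp [shiftedSum, roundsOf]

@[simp] theorem noiseSum_nil (u : Fin U) : noiseSum DT DG source ψ [] u = 0 := by
  simp [noiseSum]

theorem isRidge_gram {past : List (Round U b)}
    (h : ∀ ρ ∈ past, (DGᵀ *ᵥ ρ.arm) ⬝ᵥ (DGᵀ *ᵥ ρ.arm) ≤ 1) (u : Fin U) :
    IsRidge (gram DG past u) (roundsOf past u).length := by
  induction past with
  | nil => simpa [roundsOf] using IsRidge.one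
  | cons ρ past ih =>
    have ih' := ih fun σ hσ => h σ (List.mem_cons_of_mem _ hσ)
    rw [gram_cons, count_cons]
    split_ifs
    · exact ih'.add_vecMulVec (h ρ List.mem_cons_self)
    · exact ih'

/-- The error splits into the noise and the bias `-ψ`, which comes from the regularizer `I` in the
Gram matrix. -/
theorem ridgeEstimate_sub {past : List (Round U b)} {u : Fin U} {t : ℕ}
    (h : IsRidge (gram DG past u) t) :
    ridgeEstimate DT DG source past u - ψ u =
      (gram DG past u)⁻¹ *ᵥ (noiseSum DT DG source ψ past u - ψ u) := by
  conv_lhs => rw [← h.inv_mul_mulVec (ψ u)]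
  rw [ridgeEstimate_eq, ← mulVec_sub, noiseSum, sub_mulVec, one_mulVec]
  congr 1
  abel

end Statistics

/-! ### Optimistic choice of an arm -/

section Argmax

theorem firstArgmax_spec {k : ℕ} (f : Fin (k + 1) → ℝ) (j : Fin (k + 1)) :
    f j ≤ f (firstArgmax f) := by
  have := Finset.min'_mem (Finset.univ.filter (fun i => ∀ j, f j ≤ f i)) (by
    obtain ⟨i, hi⟩ := Finite.exists_max f
    exact ⟨i, by simpa using hi⟩)
  exact (Finset.mem_filter.1 this).2 j

theorem firstArgmax_eq_iff {k : ℕ} (f : Fin (k + 1) → ℝ) (i : Fin (k + 1)) :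
    firstArgmax f = i ↔ (∀ j, f j ≤ f i) ∧ ∀ l < i, ¬ ∀ j, f j ≤ f l := by
  rw [firstArgmax, Finset.min'_eq_iff]
  simp only [Finset.mem_filter, Finset.mem_univ, true_and]
  refine and_congr_right fun _ => forall_congr' fun l => ?_
  rw [imp_not_comm, not_lt]

/-- Optimism: if the estimates are off by at most the confidence widths, then the arm with the
largest optimistic estimate loses at most twice its own width. -/
theorem sub_firstArgmax_le {k : ℕ} (f g c : Fin (k + 1) → ℝ) (h : ∀ i, |f i - g i| ≤ c i)
    (i : Fin (k + 1)) :
    g i - g (firstArgmax fun i => f i + c i) ≤ 2 * c (firstArgmax fun i => f i + c i) := by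
  have h1 := firstArgmax_spec (fun i => f i + c i) i
  have h2 := abs_le.1 (h i)
  have h3 := abs_le.1 (h (firstArgmax fun i => f i + c i))
  linarith [h2.1, h3.2]

end Argmax

/-! ### Measurability of the algorithm, through the statistics it uses rather than through the list
of past rounds -/

section Measurability

variable {Ω : Type*} {mΩ : MeasurableSpace Ω}

theorem measurable_apply_of_countable {ι β : Type*} [Countable ι] [MeasurableSpace ι]
    [MeasurableSingletonClass ι] [MeasurableSpace β] {f : ι → Ω → β} (hf : ∀ i, Measurable (f i))
    {g : Ω → ι} (hg : Measurable g) : Measurable fun ω => f (g ω) ω := by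
  have : Measurable fun p : ι × Ω => f p.1 p.2 := measurable_from_prod_countable_right hf
  exact this.comp (hg.prodMk measurable_id)

theorem measurable_firstArgmax {k : ℕ} {f : Fin (k + 1) → Ω → ℝ} (hf : ∀ i, Measurable (f i)) :
    Measurable fun ω => firstArgmax fun i => f i ω := by
  refine measurable_to_countable' fun i => ?_
  have hmax : ∀ i, MeasurableSet {ω | ∀ j, f j ω ≤ f i ω} := fun i => by
    rw [Set.ofPred_forall]
    exact MeasurableSet.iInter fun j => measurableSet_le (hf j) (hf i)
  have : (fun ω => firstArgmax fun i => f i ω) ⁻¹' {i} =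
      {ω | ∀ j, f j ω ≤ f i ω} ∩ ⋂ l : {l // l < i}, {ω | ∀ j, f j ω ≤ f l ω}ᶜ := by
    ext ω
    simp [firstArgmax_eq_iff]
  rw [this]
  exact (hmax i).inter (MeasurableSet.iInter fun l => (hmax l).compl)

theorem measurable_dotProduct {m : Type*} [Fintype m] {x y : Ω → m → ℝ} (hx : Measurable x)
    (hy : Measurable y) : Measurable fun ω => x ω ⬝ᵥ y ω := by
  unfold dotProduct
  fun_prop

theorem measurable_mulVec {m n : Type*} [Fintype n] {M : Ω → Matrix m n ℝ} {x : Ω → n → ℝ}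
    (hM : ∀ i j, Measurable fun ω => M ω i j) (hx : Measurable x) :
    Measurable fun ω => M ω *ᵥ x ω :=
  measurable_pi_lambda _ fun i => measurable_dotProduct (measurable_pi_lambda _ (hM i)) hx

theorem measurable_det {m : Type*} [Fintype m] [DecidableEq m] {M : Ω → Matrix m m ℝ}
    (hM : ∀ i j, Measurable fun ω => M ω i j) : Measurable fun ω => (M ω).det := by
  simp only [det_apply]
  fun_prop

/-- By Cramer's rule the entries are quotients of determinants, also for singular matrices since
both sides are then `0`. -/
theorem measurable_inv {m : Type*} [Fintype m] [DecidableEq m] {M : Ω → Matrix m m ℝ}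
    (hM : ∀ i j, Measurable fun ω => M ω i j) (i j : m) : Measurable fun ω => (M ω)⁻¹ i j := by
  have : (fun ω => (M ω)⁻¹ i j) =
      fun ω => (M ω).det⁻¹ * ((M ω).updateRow j (Pi.single i 1)).det := by
    ext ω
    rw [inv_def, Ring.inverse_eq_inv', Matrix.smul_apply, adjugate_apply, smul_eq_mul]
  rw [this]
  refine (measurable_det hM).inv.mul (measurable_det fun k l => ?_)
  by_cases hk : k = j
  · subst hk
    simp only [updateRow_self]
    exact measurable_const
  · simp only [updateRow_ne hk]
    exact hM _ _

theorem measurable_mixture {d : ℕ} {V : Ω → Matrix (Fin d) (Fin d) ℝ} {s : Ω → Fin d → ℝ}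
    (hV : ∀ i j, Measurable fun ω => V ω i j) (hs : Measurable s) :
    Measurable fun ω => mixture (V ω) (s ω) := by
  unfold mixture
  have h1 := measurable_dotProduct hs (measurable_mulVec (measurable_inv hV) hs)
  have h2 := measurable_det hV
  fun_prop

variable {U a b d : ℕ} (DT : Matrix (Fin b) (Fin a) ℝ) (DG : Matrix (Fin b) (Fin d) ℝ)
  (source : Fin U → Fin a → ℝ) (ψ : Fin U → Fin d → ℝ)

/-- The statistics of a random history that shifted LinUCB uses are measurable. -/
structure MeasurableStats (m : MeasurableSpace Ω) (past : Ω → List (Round U b)) : Prop where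
  count : ∀ u, Measurable[m] fun ω => (roundsOf (past ω) u).length
  gram : ∀ u i j, Measurable[m] fun ω => gram DG (past ω) u i j
  sum : ∀ u, Measurable[m] fun ω => shiftedSum DT DG source (past ω) u

namespace MeasurableStats

variable {DT DG source}

theorem nil : MeasurableStats DT DG source mΩ (fun _ : Ω => ([] : List (Round U b))) := by
  refine ⟨fun u => measurable_const, fun u i j => measurable_const, fun u => measurable_const⟩

theorem cons {past : Ω → List (Round U b)} (h : MeasurableStats DT DG source mΩ past)
    {u : Ω → Fin U} {x : Ω → Fin b → ℝ} {y : Ω → ℝ} (hu : Measurable u) (hx : Measurable x)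
    (hy : Measurable y) : MeasurableStats DT DG source mΩ (fun ω => ⟨u ω, x ω, y ω⟩ :: past ω) := by
  have hset : ∀ v, MeasurableSet {ω | u ω = v} := fun v => hu (measurableSet_singleton v)
  have hz : Measurable fun ω => DGᵀ *ᵥ x ω := measurable_mulVec (fun _ _ => measurable_const) hx
  refine ⟨fun v => ?_, fun v i j => ?_, fun v => ?_⟩
  · simp only [count_cons]
    exact Measurable.ite (hset v) ((h.count v).add_const 1) (h.count v)
  · simp only [gram_cons, apply_ite (fun M : Matrix (Fin d) (Fin d) ℝ => M i j), Matrix.add_apply,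
      vecMulVec_apply]
    exact Measurable.ite (hset v) ((h.gram v i j).add
      (((measurable_pi_apply i).comp hz).mul ((measurable_pi_apply j).comp hz))) (h.gram v i j)
  · simp only [shiftedSum_cons]
    exact Measurable.ite (hset v) ((h.sum v).add
      ((hy.sub (measurable_dotProduct hx measurable_const)).smul hz)) (h.sum v)

variable {past : Ω → List (Round U b)} (h : MeasurableStats DT DG source mΩ past)
include h

theorem noiseSum (u : Fin U) : Measurable fun ω => noiseSum DT DG source ψ (past ω) u := by
  unfold SkylineBandit.noiseSum
  refine (h.sum u).sub (measurable_mulVec (fun i j => ?_) measurable_const)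
  exact (h.gram u i j).sub measurable_const

theorem upperConfidence (radius : ℕ → ℕ → ℝ) (u : Fin U) {z : Ω → Fin d → ℝ} (hz : Measurable z) :
    Measurable fun ω => upperConfidence DT DG source radius (past ω) u (z ω) := by
  unfold SkylineBandit.upperConfidence
  have hinv := measurable_inv (h.gram u)
  have h1 := measurable_dotProduct hz (measurable_mulVec hinv (h.sum u))
  have h2 := measurable_dotProduct hz (measurable_mulVec hinv hz)
  have h3 : Measurable fun ω => radius d (roundsOf (past ω) u).length :=
    (measurable_from_nat (f := radius d)).comp (h.count u)
  exact h1.add (h3.mul h2.sqrt)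

theorem choice (radius : ℕ → ℕ → ℝ) {u : Ω → Fin U} {k : ℕ} {x : Fin (k + 1) → Ω → Fin b → ℝ}
    (hu : Measurable u) (hx : ∀ i, Measurable (x i)) :
    Measurable fun ω =>
      shiftedLinUCB DT DG source radius (past ω) (u ω) k (fun i => x i ω) := by
  unfold shiftedLinUCB
  refine measurable_apply_of_countable (f := fun v ω => firstArgmax fun i =>
    x i ω ⬝ᵥ DT *ᵥ source v + SkylineBandit.upperConfidence DT DG source radius (past ω) v
      (DGᵀ *ᵥ x i ω)) (fun v => measurable_firstArgmax fun i => ?_) hu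
  exact (measurable_dotProduct (hx i) measurable_const).add
    (h.upperConfidence radius v (measurable_mulVec (fun _ _ => measurable_const) (hx i)))

end MeasurableStats

end Measurability

/-! ### Sums of squared logarithms and the confidence radius -/

section Numeric

theorem log_one_add_le_two_mul_sqrt {y : ℝ} (hy : 0 ≤ y) : Real.log (1 + y) ≤ 2 * √y := by
  have h0 := Real.sqrt_nonneg y
  have h1 : 1 + y ≤ (1 + √y) ^ 2 := by nlinarith [Real.sq_sqrt hy]
  have h2 := Real.log_le_log (by linarith) h1
  rw [Real.log_pow] at h2
  have h3 := Real.log_le_sub_one_of_pos (show 0 < 1 + √y by linarith)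
  push_cast at h2
  linarith

/-- A substitute for Jensen's inequality, as `log² (1 + x)` is not concave near `0`: a bound affine
in `x`, with `m` to be the mean number of visits. It comes from `1 + x ≤ (1 + m) (1 + x / m)`. -/
theorem sq_log_one_add_le {m x : ℝ} (hm : 0 < m) (hx : 0 ≤ x) :
    Real.log (1 + x) ^ 2 ≤ 2 * Real.log (1 + m) ^ 2 + 8 * (x / m) := by
  have hy : 0 ≤ x / m := by positivity
  have h1 : 1 + x ≤ (1 + m) * (1 + x / m) := by
    have : (1 + m) * (1 + x / m) = 1 + m + x / m + x := by field_simp; ring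
    rw [this]; linarith
  have h2 := Real.log_le_log (by linarith) h1
  rw [Real.log_mul (by positivity) (by positivity)] at h2
  have h3 := log_one_add_le_two_mul_sqrt hy
  have h4 : 0 ≤ Real.log (1 + x) := Real.log_nonneg (by linarith)
  have h5 := Real.sq_sqrt hy
  have h6 : Real.log (1 + x) ^ 2 ≤ (Real.log (1 + m) + 2 * √(x / m)) ^ 2 :=
    pow_le_pow_left₀ h4 (by linarith) 2
  nlinarith [sq_nonneg (Real.log (1 + m) - 2 * √(x / m))]

theorem half_le_log {m : ℝ} (hm : 2 ≤ m) : 1 / 2 ≤ Real.log m := by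
  have := Real.log_two_gt_d9
  have := Real.log_le_log (by norm_num) hm
  linarith

/-- Summing the affine bound at `m = H / U` leaves `2 U log² (1 + m) + 8 U`. Since `m ≥ 2`, `log (1
+ m) ≤ 2 log m` and `1 ≤ 4 log² m`, so the constant is `8 + 32`. -/
theorem sum_sq_log_le {U H : ℕ} (hU : 0 < U) (hH : 2 * U ≤ H) (x : Fin U → ℕ)
    (hx : ∑ u, x u = H) :
    ∑ u, Real.log (1 + x u) ^ 2 ≤ 40 * U * Real.log ((H : ℝ) / U) ^ 2 := by
  have hU' : (0 : ℝ) < U := by exact_mod_cast hU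
  have hm : (2 : ℝ) ≤ (H : ℝ) / U := by
    rw [le_div_iff₀ hU']; exact_mod_cast hH
  set m := (H : ℝ) / U with hmdef
  have h1 : Real.log (1 + m) ≤ 2 * Real.log m := by
    rw [show 2 * Real.log m = Real.log (m ^ 2) by rw [Real.log_pow]; norm_num]
    exact Real.log_le_log (by linarith) (by nlinarith)
  have h0 : 0 ≤ Real.log (1 + m) := Real.log_nonneg (by linarith)
  have h2 := half_le_log hm
  have hsum : ∑ u, (x u : ℝ) / m = U := by
    rw [← Finset.sum_div, ← Nat.cast_sum, hx, hmdef]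
    have : (H : ℝ) ≠ 0 := by
      have : 0 < H := by omega
      positivity
    field_simp
  calc ∑ u, Real.log (1 + x u) ^ 2
      ≤ ∑ u, (2 * Real.log (1 + m) ^ 2 + 8 * ((x u : ℝ) / m)) :=
        Finset.sum_le_sum fun u _ => sq_log_one_add_le (by linarith) (Nat.cast_nonneg _)
    _ = U * (2 * Real.log (1 + m) ^ 2) + 8 * U := by
        rw [Finset.sum_add_distrib, ← Finset.mul_sum _ (fun u => (x u : ℝ) / m), hsum]; simp
    _ ≤ U * (2 * (2 * Real.log m) ^ 2) + 8 * U * (4 * Real.log m ^ 2) := by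
        have h3 : (1 : ℝ) ≤ 4 * Real.log m ^ 2 := by nlinarith
        refine add_le_add ?_ (le_mul_of_one_le_right (by positivity) h3)
        gcongr
    _ = 40 * U * Real.log m ^ 2 := by ring

end Numeric

/-- The radius `1 + √((d + 4) log (1 + t))` of the confidence ellipsoids. -/
def confidenceRadius (d t : ℕ) : ℝ := 1 + √((d + 4) * Real.log (1 + t))

theorem confidenceRadius_pos (d t : ℕ) : 0 < confidenceRadius d t := by
  unfold confidenceRadius; positivity

theorem confidenceRadius_mono (d : ℕ) {s t : ℕ} (h : s ≤ t) :
    confidenceRadius d s ≤ confidenceRadius d t := by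
  unfold confidenceRadius
  gcongr

theorem confidenceRadius_sq_le {d t : ℕ} (hd : 0 < d) (ht : 0 < t) :
    confidenceRadius d t ^ 2 ≤ 14 * d * Real.log (1 + t) := by
  have hd' : (1 : ℝ) ≤ d := by exact_mod_cast hd
  have ht' : (1 : ℝ) ≤ t := by exact_mod_cast ht
  have hl := half_le_log (show (2 : ℝ) ≤ 1 + t by linarith)
  have h0 : 0 ≤ (d + 4) * Real.log (1 + t) := by positivity
  have h := Real.sq_sqrt h0
  unfold confidenceRadius
  have h1 : (1 + √((d + 4) * Real.log (1 + t))) ^ 2 ≤ 2 + 2 * ((d + 4) * Real.log (1 + t)) := by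
    nlinarith [sq_nonneg (1 - √((d + 4) * Real.log (1 + t)))]
  nlinarith

/-! ### Bounds on every sample path -/

section Play

variable {Ω : Type*} [MeasurableSpace Ω] {P : Measure Ω} {U b H a d : ℕ}
  (E : Environment P U b H) (param : Fin U → Fin b → ℝ) (π : Policy U b)
  (DT : Matrix (Fin b) (Fin a) ℝ) (DG : Matrix (Fin b) (Fin d) ℝ)
  (source : Fin U → Fin a → ℝ) (ψ : Fin U → Fin d → ℝ)

theorem Environment.history_succ (ω : Ω) (h : ℕ) :
    E.history param π ω (h + 1) = ⟨E.user h ω, E.pulled param π h ω, E.reward param π h ω⟩ ::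
      E.history param π ω h := rfl

/-- The number of rounds of user `u` before round `h`. -/
def Environment.visits (h : ℕ) (u : Fin U) (ω : Ω) : ℕ :=
  (roundsOf (E.history param π ω h) u).length

/-- The squared width `zᵀ V⁻¹ z` of the confidence interval of the arm pulled in round `h`. -/
def Environment.width (h : ℕ) (ω : Ω) : ℝ :=
  (DGᵀ *ᵥ E.pulled param π h ω) ⬝ᵥ
    (gram DG (E.history param π ω h) (E.user h ω))⁻¹ *ᵥ (DGᵀ *ᵥ E.pulled param π h ω)

/-- The mixture martingale of user `u` before round `h`. -/
def Environment.mixture (h : ℕ) (u : Fin U) (ω : Ω) : ℝ :=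
  SkylineBandit.mixture (gram DG (E.history param π ω h) u)
    (noiseSum DT DG source ψ (E.history param π ω h) u)

/-- The regret of round `h` before adding the noise. -/
def Environment.gap (h : ℕ) (ω : Ω) : ℝ :=
  E.best param h ω - E.pulled param π h ω ⬝ᵥ param (E.user h ω)

/-- The mean rewards `⟨x, param u⟩` split into known shifts `⟨x, D_T A θᵘ⟩` and linear functions
`⟨D_Gᵀ x, ψ u⟩` of a contraction of the arm. -/
structure IsShift : Prop where
  contraction : ∀ x, (DGᵀ *ᵥ x) ⬝ᵥ (DGᵀ *ᵥ x) ≤ x ⬝ᵥ x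
  mean_eq : ∀ u x, x ⬝ᵥ param u = x ⬝ᵥ DT *ᵥ source u + (DGᵀ *ᵥ x) ⬝ᵥ ψ u
  param_le : ∀ u, param u ⬝ᵥ param u ≤ 1
  shifted_le : ∀ u, ψ u ⬝ᵥ ψ u ≤ 1

theorem Environment.visits_succ (h : ℕ) (u : Fin U) (ω : Ω) :
    E.visits param π (h + 1) u ω =
      if E.user h ω = u then E.visits param π h u ω + 1 else E.visits param π h u ω := by
  rw [Environment.visits, history_succ, count_cons]; rfl

theorem Environment.visits_mono (u : Fin U) (ω : Ω) :
    Monotone fun h => E.visits param π h u ω := by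
  refine monotone_nat_of_le_succ fun h => ?_
  rw [visits_succ]; split_ifs <;> omega

theorem Environment.sum_visits (h : ℕ) (ω : Ω) : ∑ u, E.visits param π h u ω = h := by
  induction h with
  | zero => simp [visits, history, roundsOf]
  | succ h ih =>
    have : ∀ u, E.visits param π (h + 1) u ω =
        E.visits param π h u ω + if E.user h ω = u then 1 else 0 := fun u => by
      rw [visits_succ]; split_ifs <;> simp
    simp only [this, Finset.sum_add_distrib, ih, Finset.sum_ite_eq, Finset.mem_univ, if_true]

theorem Environment.arm_dotProduct_le {h : ℕ} (hh : h < H) (k) (ω : Ω) :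
    E.arm h k ω ⬝ᵥ E.arm h k ω ≤ 1 := by
  rw [← norm_toLp_sq]
  exact pow_le_one₀ (norm_nonneg _) (E.arm_norm_le h hh k ω)

variable {param DT DG source ψ} (S : IsShift param DT DG source ψ)
include S

theorem Environment.pulled_le {h : ℕ} (hh : h < H) (ω : Ω) :
    (DGᵀ *ᵥ E.pulled param π h ω) ⬝ᵥ (DGᵀ *ᵥ E.pulled param π h ω) ≤ 1 :=
  (S.contraction _).trans (E.arm_dotProduct_le hh _ ω)

theorem Environment.isRidge_gram {h : ℕ} (hh : h ≤ H) (u : Fin U) (ω : Ω) :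
    IsRidge (gram DG (E.history param π ω h) u) (E.visits param π h u ω) := by
  refine SkylineBandit.isRidge_gram DG ?_ u
  induction h with
  | zero => simp [history]
  | succ h ih =>
    rw [history_succ]
    intro ρ hρ
    rcases List.mem_cons.1 hρ with rfl | hρ
    · exact E.pulled_le π S hh ω
    · exact ih (Nat.le_of_succ_le hh) ρ hρ

theorem Environment.width_nonneg {h : ℕ} (hh : h < H) (ω : Ω) : 0 ≤ E.width param π DG h ω :=
  (E.isRidge_gram π S hh.le _ ω).inv_nonneg _

/-- Subtracting the shift and `⟨z, ψ⟩` from the reward leaves exactly the noise of the round. -/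
theorem Environment.noiseSum_succ (h : ℕ) (u : Fin U) (ω : Ω) :
    noiseSum DT DG source ψ (E.history param π ω (h + 1)) u = if E.user h ω = u then
      noiseSum DT DG source ψ (E.history param π ω h) u +
        E.noise h ω • DGᵀ *ᵥ E.pulled param π h ω
      else noiseSum DT DG source ψ (E.history param π ω h) u := by
  rw [history_succ, noiseSum_cons]
  split_ifs with hu
  · simp only at hu
    congr 2
    simp only [reward]
    rw [S.mean_eq, hu]
    ring
  · rfl

theorem Environment.mixture_succ {h : ℕ} (hh : h < H) (u : Fin U) (ω : Ω) :
    E.mixture param π DT DG source ψ (h + 1) u ω = if E.user h ω = u then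
      E.mixture param π DT DG source ψ h u ω *
        growth ((DGᵀ *ᵥ E.pulled param π h ω) ⬝ᵥ (gram DG (E.history param π ω h) u)⁻¹ *ᵥ
          noiseSum DT DG source ψ (E.history param π ω h) u)
          ((DGᵀ *ᵥ E.pulled param π h ω) ⬝ᵥ (gram DG (E.history param π ω h) u)⁻¹ *ᵥ
            (DGᵀ *ᵥ E.pulled param π h ω)) (E.noise h ω)
      else E.mixture param π DT DG source ψ h u ω := by
  rw [Environment.mixture, E.noiseSum_succ π S, history_succ, gram_cons]
  split_ifs with hu
  · exact (E.isRidge_gram π S hh.le u ω).mixture_add (E.pulled_le π S hh ω) _ _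
  · rfl

/-- Elliptical potential of one user. -/
theorem Environment.sum_width_le {h : ℕ} (hh : h ≤ H) (u : Fin U) (ω : Ω) :
    ∑ j ∈ Finset.range h, (if E.user j ω = u then E.width param π DG j ω else 0) ≤
      2 * (d * Real.log (1 + E.visits param π h u ω)) := by
  have key : ∀ k ≤ H,
      ∑ j ∈ Finset.range k, (if E.user j ω = u then E.width param π DG j ω else 0) ≤
        2 * Real.log (gram DG (E.history param π ω k) u).det := by
    intro k
    induction k with
    | zero => simp [history]
    | succ k ih =>
      intro hk
      have ih := ih (Nat.le_of_succ_le hk)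
      rw [Finset.sum_range_succ, history_succ, gram_cons]
      split_ifs with hu
      · have := (E.isRidge_gram π S (Nat.le_of_succ_le hk) u ω).le_log_det_sub
          (E.pulled_le π S hk ω)
        rw [Environment.width, hu]
        linarith
      · linarith
  have := (E.isRidge_gram π S hh u ω).log_det_le
  linarith [key h hh]

/-- The confidence widths of the pulled arms have a small sum on every sample path. -/
theorem Environment.sum_radius_mul_le (hd : 0 < d) (hU : 0 < U) (hH : 2 * U ≤ H) (ω : Ω) :
    ∑ h ∈ Finset.range H, confidenceRadius d (E.visits param π h (E.user h ω) ω) *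
      √(E.width param π DG h ω) ≤
      34 * d * √((U : ℝ) * H) * Real.log ((H : ℝ) / U) := by
  set N := fun u => E.visits param π H u ω with hN
  have hterm : ∀ u, ∑ h ∈ Finset.range H, (if E.user h ω = u then
      confidenceRadius d (E.visits param π h u ω) ^ 2 * E.width param π DG h ω else 0) ≤
      28 * d ^ 2 * Real.log (1 + N u) ^ 2 := by
    intro u
    -- The bound on the squared radius needs at least one visit; a user never seen contributes
    -- nothing.
    rcases Nat.eq_zero_or_pos (N u) with h0 | hpos
    · refine (Finset.sum_nonpos fun h hh => ?_).trans (by positivity)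
      rw [if_neg]
      intro hu
      have h1 := E.visits_mono param π u ω (Nat.succ_le_of_lt (Finset.mem_range.1 hh))
      simp only [Nat.succ_eq_add_one, visits_succ, if_pos hu] at h1
      simp only [hN] at h0
      omega
    · calc _ ≤ ∑ h ∈ Finset.range H, confidenceRadius d (N u) ^ 2 *
            (if E.user h ω = u then E.width param π DG h ω else 0) := by
            refine Finset.sum_le_sum fun h hh => ?_
            have hh := Finset.mem_range.1 hh
            split_ifs
            · have h1 := confidenceRadius_mono d (E.visits_mono param π u ω hh.le)
              have h2 := (confidenceRadius_pos d (E.visits param π h u ω)).le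
              have h3 := E.width_nonneg π S hh ω
              exact mul_le_mul_of_nonneg_right (pow_le_pow_left₀ h2 h1 2) h3
            · simp
        _ ≤ (14 * d * Real.log (1 + N u)) * (2 * (d * Real.log (1 + N u))) := by
            rw [← Finset.mul_sum]
            exact mul_le_mul (confidenceRadius_sq_le hd hpos) (E.sum_width_le π S le_rfl u ω)
              (Finset.sum_nonneg fun h hh => by
                split_ifs
                · exact E.width_nonneg π S (Finset.mem_range.1 hh) ω
                · exact le_rfl)
              (mul_nonneg (by positivity) (Real.log_nonneg (by simp)))
        _ = _ := by ring
  have hsq : ∑ h ∈ Finset.range H, (confidenceRadius d (E.visits param π h (E.user h ω) ω) *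
      √(E.width param π DG h ω)) ^ 2 ≤ 28 * d ^ 2 * (40 * U * Real.log ((H : ℝ) / U) ^ 2) := by
    calc _ = ∑ h ∈ Finset.range H, ∑ u, (if E.user h ω = u then
          confidenceRadius d (E.visits param π h u ω) ^ 2 * E.width param π DG h ω else 0) := by
          refine Finset.sum_congr rfl fun h hh => ?_
          rw [Finset.sum_ite_eq, if_pos (Finset.mem_univ _), mul_pow,
            Real.sq_sqrt (E.width_nonneg π S (Finset.mem_range.1 hh) ω)]
      _ = ∑ u, ∑ h ∈ Finset.range H, (if E.user h ω = u then
          confidenceRadius d (E.visits param π h u ω) ^ 2 * E.width param π DG h ω else 0) :=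
          Finset.sum_comm
      _ ≤ ∑ u, 28 * d ^ 2 * Real.log (1 + N u) ^ 2 := Finset.sum_le_sum fun u _ => hterm u
      _ ≤ _ := by
          rw [← Finset.mul_sum]
          gcongr
          exact sum_sq_log_le hU hH N (E.sum_visits param π H ω)
  have hU' : (0 : ℝ) < U := by exact_mod_cast hU
  have hlog : 0 ≤ Real.log ((H : ℝ) / U) := by
    have : (2 : ℝ) ≤ (H : ℝ) / U := by
      rw [le_div_iff₀ hU']; exact_mod_cast hH
    linarith [half_le_log this]
  refine abs_le_of_sq_le_sq' ?_ (by positivity) |>.2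
  -- Cauchy-Schwarz over the `H` rounds; the constant works because `28 * 40 = 1120 ≤ 34²`.
  refine (sq_sum_le_card_mul_sum_sq (s := Finset.range H)).trans ?_
  rw [Finset.card_range, mul_pow, mul_pow, Real.sq_sqrt (by positivity)]
  refine (mul_le_mul_of_nonneg_left hsq (Nat.cast_nonneg H)).trans ?_
  have : 0 ≤ (d : ℝ) ^ 2 * (U * H) * Real.log ((H : ℝ) / U) ^ 2 := by positivity
  nlinarith

omit S in
theorem Environment.gap_nonneg (h : ℕ) (ω : Ω) : 0 ≤ E.gap param π h ω := by
  rw [gap, sub_nonneg]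
  exact Finset.le_sup' (fun k => E.arm h k ω ⬝ᵥ param (E.user h ω)) (Finset.mem_univ _)

theorem Environment.abs_mean_le {h : ℕ} (hh : h < H) (k) (ω : Ω) :
    |E.arm h k ω ⬝ᵥ param (E.user h ω)| ≤ 1 := by
  rw [← sq_le_one_iff_abs_le_one]
  exact (dotProduct_sq_le _ _).trans (mul_le_one₀ (E.arm_dotProduct_le hh k ω)
    (zero_le_dotProduct_self _) (S.param_le _))

theorem Environment.gap_le_two {h : ℕ} (hh : h < H) (ω : Ω) : E.gap param π h ω ≤ 2 := by
  have h1 : E.best param h ω ≤ 1 :=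
    Finset.sup'_le _ _ fun k _ => (abs_le.1 (E.abs_mean_le S hh k ω)).2
  have h2 := (abs_le.1 (E.abs_mean_le S hh
    (π (E.history param π ω h) (E.user h ω) (E.lastArm h) fun k => E.arm h k ω) ω)).1
  rw [gap, pulled]
  linarith

end Play

/-! ### Regret of a single round -/

section Regret

variable {Ω : Type*} [mΩ : MeasurableSpace Ω] {P : Measure Ω} {U b H a d : ℕ}
  (E : Environment P U b H) {param : Fin U → Fin b → ℝ}
  {DT : Matrix (Fin b) (Fin a) ℝ} {DG : Matrix (Fin b) (Fin d) ℝ}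
  {source : Fin U → Fin a → ℝ} {ψ : Fin U → Fin d → ℝ}

/-- In a round whose confidence ellipsoid contains the true parameter, the regret is at most twice
the confidence width of the pulled arm. -/
theorem Environment.gap_le_of_noiseSum_le (S : IsShift param DT DG source ψ) {h : ℕ} (hh : h < H)
    (ω : Ω) {π : Policy U b} (hπ : π = shiftedLinUCB DT DG source confidenceRadius)
    (hs : noiseSum DT DG source ψ (E.history param π ω h) (E.user h ω) ⬝ᵥ
      (gram DG (E.history param π ω h) (E.user h ω))⁻¹ *ᵥ
        noiseSum DT DG source ψ (E.history param π ω h) (E.user h ω) ≤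
      (d + 4) * Real.log (1 + E.visits param π h (E.user h ω) ω)) :
    E.gap param π h ω ≤ 2 * (confidenceRadius d (E.visits param π h (E.user h ω) ω) *
      √(E.width param π DG h ω)) := by
  set u := E.user h ω with hu
  set past := E.history param π ω h with hpast
  have hR := E.isRidge_gram π S hh.le u ω
  let β := confidenceRadius d (E.visits param π h u ω)
  let f : Fin (E.lastArm h + 1) → ℝ := fun i =>
    E.arm h i ω ⬝ᵥ DT *ᵥ source u + (DGᵀ *ᵥ E.arm h i ω) ⬝ᵥ ridgeEstimate DT DG source past u
  let g : Fin (E.lastArm h + 1) → ℝ := fun i => E.arm h i ω ⬝ᵥ param u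
  let c : Fin (E.lastArm h + 1) → ℝ := fun i => β *
    √((DGᵀ *ᵥ E.arm h i ω) ⬝ᵥ (gram DG past u)⁻¹ *ᵥ (DGᵀ *ᵥ E.arm h i ω))
  have hfg : ∀ i, |f i - g i| ≤ c i := by
    intro i
    have := hR.abs_error_le hs (S.shifted_le u) (DGᵀ *ᵥ E.arm h i ω)
    rw [← ridgeEstimate_sub DT DG source ψ hR, dotProduct_sub] at this
    simp only [f, g, S.mean_eq, add_sub_add_left_eq_sub]
    exact this
  have hchoice : π past u (E.lastArm h) (fun k => E.arm h k ω) =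
      firstArgmax fun i => f i + c i := by
    rw [hπ]
    simp only [shiftedLinUCB, f, c, upperConfidence, ← add_assoc]
    rfl
  rw [gap, best, pulled, width, pulled, ← hu, ← hpast, hchoice, sub_le_iff_le_add]
  refine Finset.sup'_le _ _ fun i _ => ?_
  have := sub_firstArgmax_le f g c hfg i
  simp only [g, c] at this ⊢
  linarith

/-- The regret of a round is bounded by the confidence width plus a multiple of the mixture
martingale, which pays for the rounds in which the confidence ellipsoid is wrong. -/
theorem Environment.gap_le (S : IsShift param DT DG source ψ) {h : ℕ} (hh : h < H)
    (ω : Ω) {π : Policy U b} (hπ : π = shiftedLinUCB DT DG source confidenceRadius) :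
    E.gap param π h ω ≤ 2 * (confidenceRadius d (E.visits param π h (E.user h ω) ω) *
      √(E.width param π DG h ω)) + 2 * (E.mixture param π DT DG source ψ h (E.user h ω) ω /
        (1 + E.visits param π h (E.user h ω) ω : ℝ) ^ 2) := by
  have h1 := (confidenceRadius_pos d (E.visits param π h (E.user h ω) ω)).le
  have h2 := mixture_nonneg (gram DG (E.history param π ω h) (E.user h ω))
    (noiseSum DT DG source ψ (E.history param π ω h) (E.user h ω))
  rcases le_total (noiseSum DT DG source ψ (E.history param π ω h) (E.user h ω) ⬝ᵥ
      (gram DG (E.history param π ω h) (E.user h ω))⁻¹ *ᵥ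
        noiseSum DT DG source ψ (E.history param π ω h) (E.user h ω))
      ((d + 4) * Real.log (1 + E.visits param π h (E.user h ω) ω)) with hs | hs
  · have h3 := E.gap_le_of_noiseSum_le S hh ω hπ hs
    have : 0 ≤ E.mixture param π DT DG source ψ h (E.user h ω) ω /
        (1 + E.visits param π h (E.user h ω) ω : ℝ) ^ 2 := div_nonneg h2 (by positivity)
    linarith
  · have h3 := (E.isRidge_gram π S hh.le (E.user h ω) ω).sq_le_mixture hs
    have h4 : 1 ≤ E.mixture param π DT DG source ψ h (E.user h ω) ω /
        (1 + E.visits param π h (E.user h ω) ω : ℝ) ^ 2 := by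
      rw [le_div_iff₀ (by positivity), one_mul]; exact h3
    have h5 := E.gap_le_two π S hh ω
    have h6 : 0 ≤ confidenceRadius d (E.visits param π h (E.user h ω) ω) *
      √(E.width param π DG h ω) := mul_nonneg h1 (Real.sqrt_nonneg _)
    linarith

end Regret

/-! ### Expected regret -/

section Expectation

variable {Ω : Type*} [mΩ : MeasurableSpace Ω] {P : Measure Ω} {U b H a d : ℕ}
  (E : Environment P U b H) {param : Fin U → Fin b → ℝ}
  {DT : Matrix (Fin b) (Fin a) ℝ} {DG : Matrix (Fin b) (Fin d) ℝ}
  {source : Fin U → Fin a → ℝ} {ψ : Fin U → Fin d → ℝ} {radius : ℕ → ℕ → ℝ}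

omit mΩ in
theorem MeasurableStats.mono {m m' : MeasurableSpace Ω} (hm : m ≤ m')
    {past : Ω → List (Round U b)} (h : MeasurableStats DT DG source m past) :
    MeasurableStats DT DG source m' past :=
  MeasurableStats.mk (fun u => (h.count u).mono hm le_rfl)
    (fun u i j => (h.gram u i j).mono hm le_rfl) (fun u => (h.sum u).mono hm le_rfl)

theorem Environment.measurable_pulled_of_stats {h : ℕ} (hh : h < H)
    (hs : MeasurableStats DT DG source (E.info h) fun ω =>
      E.history param (shiftedLinUCB DT DG source radius) ω h) :
    Measurable[E.info h] (E.pulled param (shiftedLinUCB DT DG source radius) h) :=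
  measurable_apply_of_countable (E.arm_measurable h hh)
    (hs.choice radius (E.user_measurable h hh) (E.arm_measurable h hh))

theorem Environment.measurableStats_history {h : ℕ} (hh : h ≤ H) :
    MeasurableStats DT DG source (E.info h) fun ω =>
      E.history param (shiftedLinUCB DT DG source radius) ω h := by
  induction h with
  | zero => exact MeasurableStats.nil
  | succ h ih =>
    have ih := ih (Nat.le_of_succ_le hh)
    have hm := E.info.mono (Nat.le_succ h)
    have hx := E.measurable_pulled_of_stats hh ih
    have hu := E.user_measurable h hh
    have hy : Measurable[E.info (h + 1)]
        (E.reward param (shiftedLinUCB DT DG source radius) h) := by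
      refine Measurable.add ?_ (E.noise_measurable h hh)
      refine Measurable.mono ?_ hm le_rfl
      exact measurable_dotProduct hx ((measurable_of_countable param).comp hu)
    exact (ih.mono hm).cons (hu.mono hm le_rfl) (hx.mono hm le_rfl) hy

theorem Environment.measurable_pulled {h : ℕ} (hh : h < H) :
    Measurable[E.info h] (E.pulled param (shiftedLinUCB DT DG source radius) h) :=
  E.measurable_pulled_of_stats hh (E.measurableStats_history hh.le)

theorem Environment.measurable_gap {h : ℕ} (hh : h < H) :
    Measurable (E.gap param (shiftedLinUCB DT DG source radius) h) := by
  have hm := E.info.le h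
  have hp : Measurable fun ω => param (E.user h ω) :=
    (measurable_of_countable param).comp ((E.user_measurable h hh).mono hm le_rfl)
  refine Measurable.sub ?_ (measurable_dotProduct ((E.measurable_pulled hh).mono hm le_rfl) hp)
  have := Finset.measurable_sup' (s := Finset.univ) Finset.univ_nonempty
    (f := fun k ω => E.arm h k ω ⬝ᵥ param (E.user h ω))
    fun k _ => measurable_dotProduct ((E.arm_measurable h hh k).mono hm le_rfl) hp
  convert this using 1
  ext ω
  rw [Finset.sup'_apply]
  rfl

variable [IsProbabilityMeasure P] (S : IsShift param DT DG source ψ)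
include S

/-- One round of the potential that charges the wrong confidence ellipsoids of user `u` to the
mixture martingale. -/
theorem Environment.lintegral_mixture_step {h : ℕ} (hh : h < H) (u : Fin U) {π : Policy U b}
    (hπ : π = shiftedLinUCB DT DG source radius) :
    ∫⁻ ω, ENNReal.ofReal (2 / (E.visits param π (h + 1) u ω + 1) *
        E.mixture param π DT DG source ψ (h + 1) u ω) ∂P +
      ∫⁻ ω, ENNReal.ofReal (if E.user h ω = u then E.mixture param π DT DG source ψ h u ω /
        (1 + E.visits param π h u ω : ℝ) ^ 2 else 0) ∂P ≤
    ∫⁻ ω, ENNReal.ofReal (2 / (E.visits param π h u ω + 1) *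
        E.mixture param π DT DG source ψ h u ω) ∂P := by
  have hm := E.info.le h
  have hstats : MeasurableStats DT DG source (E.info h) fun ω =>
      E.history param π ω h := hπ ▸ E.measurableStats_history hh.le
  have hx : Measurable[E.info h] (E.pulled param π h) := hπ ▸ E.measurable_pulled hh
  have hset : MeasurableSet[E.info h] {ω | E.user h ω = u} :=
    E.user_measurable h hh (measurableSet_singleton u)
  have hN : Measurable[E.info h] fun ω => (E.visits param π h u ω : ℝ) :=
    (measurable_from_nat (f := fun n : ℕ => (n : ℝ))).comp (hstats.count u)
  have hM0 : ∀ ω, 0 ≤ E.mixture param π DT DG source ψ h u ω := fun ω => mixture_nonneg _ _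
  have hM : Measurable[E.info h] (E.mixture param π DT DG source ψ h u) :=
    measurable_mixture (hstats.gram u) (hstats.noiseSum ψ u)
  have hz : Measurable[E.info h] fun ω => DGᵀ *ᵥ E.pulled param π h ω :=
    measurable_mulVec (fun _ _ => measurable_const) hx
  let V := fun ω => gram DG (E.history param π ω h) u
  let q₀ : Ω → ℝ := fun ω => (DGᵀ *ᵥ E.pulled param π h ω) ⬝ᵥ (V ω)⁻¹ *ᵥ
    noiseSum DT DG source ψ (E.history param π ω h) u
  let w₀ : Ω → ℝ := fun ω => (DGᵀ *ᵥ E.pulled param π h ω) ⬝ᵥ (V ω)⁻¹ *ᵥ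
    (DGᵀ *ᵥ E.pulled param π h ω)
  have hq₀ : Measurable[E.info h] q₀ := measurable_dotProduct hz
    (measurable_mulVec (measurable_inv (hstats.gram u)) (hstats.noiseSum ψ u))
  have hw₀ : Measurable[E.info h] w₀ := measurable_dotProduct hz
    (measurable_mulVec (measurable_inv (hstats.gram u)) hz)
  classical
  -- With `q = w = 0` the growth factor is `1`, so rounds of other users fit the same formula. The
  -- weight `c` already carries the visit count after the round, which is known before the noise.
  let q : Ω → ℝ := fun ω => if E.user h ω = u then q₀ ω else 0
  let w : Ω → ℝ := fun ω => if E.user h ω = u then w₀ ω else 0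
  let c : Ω → ℝ := fun ω => if E.user h ω = u then
    2 / (E.visits param π h u ω + 1 + 1) * E.mixture param π DT DG source ψ h u ω
    else 2 / (E.visits param π h u ω + 1) * E.mixture param π DT DG source ψ h u ω
  have hq : Measurable[E.info h] q := Measurable.ite hset hq₀ measurable_const
  have hw : Measurable[E.info h] w := Measurable.ite hset hw₀ measurable_const
  have hc : Measurable[E.info h] c := Measurable.ite hset
    ((measurable_const.div ((hN.add_const 1).add_const 1)).mul hM)
    ((measurable_const.div (hN.add_const 1)).mul hM)
  have hw0 : ∀ ω, 0 ≤ w ω := fun ω => by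
    simp only [w]
    split_ifs
    · exact (E.isRidge_gram π S hh.le u ω).inv_nonneg _
    · exact le_rfl
  have hstep : ∀ ω, ENNReal.ofReal (2 / (E.visits param π (h + 1) u ω + 1) *
      E.mixture param π DT DG source ψ (h + 1) u ω) =
      ENNReal.ofReal (c ω) * ENNReal.ofReal (growth (q ω) (w ω) (E.noise h ω)) := fun ω => by
    rw [← ENNReal.ofReal_mul' (growth_nonneg _ _ _), E.visits_succ, E.mixture_succ π S hh]
    congr 1
    simp only [c, q, w]
    split_ifs
    · push_cast; rw [mul_assoc]
    · simp [growth]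
  have hle := lintegral_mul_growth_le hm (E.noise_subgaussian h hh)
    ((E.noise_measurable h hh).mono (E.info.le _) le_rfl) (E.noise_indep h hh)
    (ENNReal.measurable_ofReal.comp hc) hq hw hw0
  simp only [hstep]
  refine (add_le_add_left hle _).trans ?_
  rw [← lintegral_add_left ((ENNReal.measurable_ofReal.comp hc).mono hm le_rfl)]
  refine lintegral_mono fun ω => ?_
  have hn : (0 : ℝ) ≤ E.visits param π h u ω := Nat.cast_nonneg _
  have h0 := hM0 ω
  simp only [Function.comp, c]
  split_ifs
  · rw [← ENNReal.ofReal_add (by positivity) (by positivity)]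
    apply ENNReal.ofReal_le_ofReal
    rw [div_eq_inv_mul (E.mixture param π DT DG source ψ h u ω), ← add_mul]
    refine mul_le_mul_of_nonneg_right ?_ h0
    rw [← sub_nonneg]
    -- With `t` visits, `2 / (t + 1) - 2 / (t + 2) = 2 / ((t + 1) (t + 2)) ≥ 1 / (t + 1)²`: the drop
    -- of the weight covers the charge.
    have : 2 / ((E.visits param π h u ω : ℝ) + 1) - (2 / ((E.visits param π h u ω : ℝ) + 1 + 1) +
        ((1 + (E.visits param π h u ω : ℝ)) ^ 2)⁻¹) = E.visits param π h u ω /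
        ((1 + (E.visits param π h u ω : ℝ)) ^ 2 * (E.visits param π h u ω + 2)) := by
      field_simp; ring
    rw [this]
    positivity
  · simp

/-- The total charge of the rounds of one user is at most two. -/
theorem Environment.sum_lintegral_mixture_le (u : Fin U) {π : Policy U b}
    (hπ : π = shiftedLinUCB DT DG source radius) :
    ∑ h ∈ Finset.range H, ∫⁻ ω, ENNReal.ofReal (if E.user h ω = u then
        E.mixture param π DT DG source ψ h u ω / (1 + E.visits param π h u ω : ℝ) ^ 2 else 0) ∂P
      ≤ 2 := by
  have key : ∀ k ≤ H, ∫⁻ ω, ENNReal.ofReal (2 / (E.visits param π k u ω + 1) *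
        E.mixture param π DT DG source ψ k u ω) ∂P +
      ∑ h ∈ Finset.range k, ∫⁻ ω, ENNReal.ofReal (if E.user h ω = u then
        E.mixture param π DT DG source ψ h u ω / (1 + E.visits param π h u ω : ℝ) ^ 2 else 0) ∂P
      ≤ 2 := by
    intro k
    induction k with
    | zero =>
      intro _
      simp [visits, mixture, history, roundsOf, mixture_one_zero]
    | succ k ih =>
      intro hk
      refine le_trans ?_ (ih (Nat.le_of_succ_le hk))
      rw [Finset.sum_range_succ, add_comm (Finset.sum _ _), ← add_assoc]
      exact add_le_add_left (E.lintegral_mixture_step S hk u hπ) _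
  exact le_add_self.trans (key H le_rfl)

omit [IsProbabilityMeasure P] S in
theorem Environment.measurable_charge {h : ℕ} (hh : h < H) (u : Fin U) {π : Policy U b}
    (hπ : π = shiftedLinUCB DT DG source radius) :
    Measurable fun ω => ENNReal.ofReal (if E.user h ω = u then
      E.mixture param π DT DG source ψ h u ω / (1 + E.visits param π h u ω : ℝ) ^ 2 else 0) := by
  have hstats : MeasurableStats DT DG source mΩ fun ω => E.history param π ω h :=
    (hπ ▸ E.measurableStats_history hh.le : MeasurableStats DT DG source (E.info h)
      fun ω => E.history param π ω h).mono (E.info.le h)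
  have hN : Measurable fun ω => (E.visits param π h u ω : ℝ) :=
    (measurable_from_nat (f := fun n : ℕ => (n : ℝ))).comp (hstats.count u)
  have hM : Measurable (E.mixture param π DT DG source ψ h u) :=
    measurable_mixture (hstats.gram u) (hstats.noiseSum ψ u)
  refine ENNReal.measurable_ofReal.comp (Measurable.ite ?_ ?_ measurable_const)
  · exact (E.user_measurable h hh).mono (E.info.le h) le_rfl (measurableSet_singleton u)
  · exact hM.div ((hN.const_add 1).pow_const 2)

/-- A bound for the sum of the confidence widths that holds on every sample path bounds the
expected regret up to `4 U`. -/
theorem Environment.lintegral_sum_gap_le {K : ℝ} {π : Policy U b}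
    (hπ : π = shiftedLinUCB DT DG source confidenceRadius)
    (hK : ∀ ω, ∑ h ∈ Finset.range H, confidenceRadius d (E.visits param π h (E.user h ω) ω) *
      √(E.width param π DG h ω) ≤ K) :
    ∫⁻ ω, ENNReal.ofReal (∑ h ∈ Finset.range H, E.gap param π h ω) ∂P ≤
      ENNReal.ofReal (2 * K) + 4 * U := by
  have hmeas : ∀ h ∈ Finset.range H, ∀ u : Fin U, Measurable fun ω => ENNReal.ofReal
      (if E.user h ω = u then E.mixture param π DT DG source ψ h u ω /
        (1 + E.visits param π h u ω : ℝ) ^ 2 else 0) := fun h hh u =>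
    E.measurable_charge (Finset.mem_range.1 hh) u hπ
  calc _ ≤ ∫⁻ ω, (ENNReal.ofReal (2 * K) + 2 * ∑ h ∈ Finset.range H, ∑ u,
        ENNReal.ofReal (if E.user h ω = u then E.mixture param π DT DG source ψ h u ω /
          (1 + E.visits param π h u ω : ℝ) ^ 2 else 0)) ∂P := by
        refine lintegral_mono fun ω => ?_
        have hnn : ∀ h u, 0 ≤ (if E.user h ω = u then E.mixture param π DT DG source ψ h u ω /
          (1 + E.visits param π h u ω : ℝ) ^ 2 else 0) := fun h u => by
          split_ifs
          · exact div_nonneg (mixture_nonneg _ _) (by positivity)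
          · exact le_rfl
        have h1 : ∑ h ∈ Finset.range H, ∑ u, ENNReal.ofReal (if E.user h ω = u then
            E.mixture param π DT DG source ψ h u ω /
            (1 + E.visits param π h u ω : ℝ) ^ 2 else 0) =
            ENNReal.ofReal (∑ h ∈ Finset.range H, ∑ u, (if E.user h ω = u then
            E.mixture param π DT DG source ψ h u ω /
            (1 + E.visits param π h u ω : ℝ) ^ 2 else 0)) := by
          rw [ENNReal.ofReal_sum_of_nonneg fun h _ => Finset.sum_nonneg fun u _ => hnn h u]
          exact Finset.sum_congr rfl fun h _ =>
            (ENNReal.ofReal_sum_of_nonneg fun u _ => hnn h u).symm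
        have h2 : ∑ h ∈ Finset.range H, E.gap param π h ω ≤ 2 * K +
            2 * ∑ h ∈ Finset.range H, ∑ u, (if E.user h ω = u then
            E.mixture param π DT DG source ψ h u ω /
            (1 + E.visits param π h u ω : ℝ) ^ 2 else 0) := by
          refine (Finset.sum_le_sum fun h hh =>
            E.gap_le S (Finset.mem_range.1 hh) ω hπ).trans ?_
          rw [Finset.sum_add_distrib, ← Finset.mul_sum, ← Finset.mul_sum]
          have := hK ω
          simp only [Finset.sum_ite_eq, Finset.mem_univ, if_true]
          linarith
        refine (ENNReal.ofReal_le_ofReal h2).trans (ENNReal.ofReal_add_le.trans ?_)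
        rw [h1]
        gcongr
        rw [ENNReal.ofReal_mul zero_le_two, ENNReal.ofReal_ofNat]
    _ = ENNReal.ofReal (2 * K) + 2 * ∑ u, ∑ h ∈ Finset.range H, ∫⁻ ω,
        ENNReal.ofReal (if E.user h ω = u then E.mixture param π DT DG source ψ h u ω /
          (1 + E.visits param π h u ω : ℝ) ^ 2 else 0) ∂P := by
        rw [lintegral_add_left measurable_const, lintegral_const, measure_univ, mul_one,
          lintegral_const_mul _ (Finset.measurable_fun_sum _ fun h hh =>
            Finset.measurable_fun_sum _ fun u _ => hmeas h hh u),
          lintegral_finsetSum _ fun h hh =>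
            Finset.measurable_fun_sum _ fun u _ => hmeas h hh u, Finset.sum_comm]
        congr 2
        exact Finset.sum_congr rfl fun h hh => lintegral_finsetSum _ fun u _ => hmeas h hh u
    _ ≤ ENNReal.ofReal (2 * K) + 2 * ∑ _u : Fin U, 2 := by
        gcongr with u
        exact E.sum_lintegral_mixture_le S u hπ
    _ = _ := by
        simp only [Finset.sum_const, Finset.card_univ, Fintype.card_fin, nsmul_eq_mul]
        ring

theorem Environment.integrable_gap {h : ℕ} (hh : h < H) :
    Integrable (E.gap param (shiftedLinUCB DT DG source radius) h) P :=
  Integrable.of_bound (E.measurable_gap hh).aestronglyMeasurable 2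
    (Filter.Eventually.of_forall fun ω => by
      rw [Real.norm_of_nonneg (E.gap_nonneg _ h ω)]
      exact E.gap_le_two _ S hh ω)

omit [IsProbabilityMeasure P] S in
theorem Environment.realizedRegret_eq (π : Policy U b) (ω : Ω) :
    E.realizedRegret param π ω =
      ∑ h ∈ Finset.range H, E.gap param π h ω - ∑ h ∈ Finset.range H, E.noise h ω := by
  rw [realizedRegret, ← Finset.sum_sub_distrib]
  refine Finset.sum_congr rfl fun h _ => ?_
  rw [gap, reward]; ring

theorem Environment.integrable_realizedRegret :
    Integrable (E.realizedRegret param (shiftedLinUCB DT DG source radius)) P := by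
  have : E.realizedRegret param (shiftedLinUCB DT DG source radius) = fun ω =>
      ∑ h ∈ Finset.range H, E.gap param (shiftedLinUCB DT DG source radius) h ω -
        ∑ h ∈ Finset.range H, E.noise h ω := funext fun ω => E.realizedRegret_eq _ ω
  rw [this]
  exact (integrable_finsetSum _ fun h hh => E.integrable_gap S (Finset.mem_range.1 hh)).sub
    (integrable_finsetSum _ fun h hh =>
      (E.noise_subgaussian h (Finset.mem_range.1 hh)).integrable)

theorem Environment.integral_realizedRegret :
    ∫ ω, E.realizedRegret param (shiftedLinUCB DT DG source radius) ω ∂P =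
      ∫ ω, ∑ h ∈ Finset.range H, E.gap param (shiftedLinUCB DT DG source radius) h ω ∂P := by
  simp only [E.realizedRegret_eq]
  have hn : ∀ h ∈ Finset.range H, Integrable (E.noise h) P := fun h hh =>
    (E.noise_subgaussian h (Finset.mem_range.1 hh)).integrable
  rw [integral_sub (integrable_finsetSum _ fun h hh =>
    E.integrable_gap S (Finset.mem_range.1 hh)) (integrable_finsetSum _ hn),
    integral_finsetSum _ hn, Finset.sum_eq_zero fun h hh => E.noise_mean h
    (Finset.mem_range.1 hh), sub_zero]

/-- Regret of shifted LinUCB for a family of mean rewards with known shifts. -/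
theorem Environment.integral_realizedRegret_le (hH : 2 * U ≤ H) :
    ∫ ω, E.realizedRegret param (shiftedLinUCB DT DG source confidenceRadius) ω ∂P ≤
      100 * d * √((U : ℝ) * H) * Real.log ((H : ℝ) / U) := by
  rw [E.integral_realizedRegret S]
  -- The term `4 U` can be absorbed only if `d ≥ 1`. For `d = 0` there is nothing to estimate: the
  -- ellipsoid never fails and all widths vanish.
  rcases Nat.eq_zero_or_pos d with rfl | hd
  · have h0 : ∀ h < H, ∀ ω, E.gap param (shiftedLinUCB DT DG source confidenceRadius) h ω ≤ 0 := by
      intro h hh ω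
      refine (E.gap_le_of_noiseSum_le S hh ω rfl ?_).trans_eq ?_
      · simp only [dotProduct, Finset.univ_eq_empty, Finset.sum_empty]
        have : 0 ≤ Real.log (1 + (E.visits param (shiftedLinUCB DT DG source confidenceRadius) h
          (E.user h ω) ω : ℝ)) := Real.log_nonneg (by simp)
        positivity
      · simp [width, dotProduct]
    simp only [Nat.cast_zero, mul_zero, zero_mul]
    exact integral_nonpos fun ω => Finset.sum_nonpos fun h hh => h0 h (Finset.mem_range.1 hh) ω
  obtain ⟨ω₀⟩ : Nonempty Ω := nonempty_of_isProbabilityMeasure P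
  have hU : 0 < U := Fin.pos (E.user 0 ω₀)
  have hU' : (0 : ℝ) < U := by exact_mod_cast hU
  have hHU : 2 * (U : ℝ) ≤ H := by exact_mod_cast hH
  have hd' : (1 : ℝ) ≤ d := by exact_mod_cast hd
  have hlog : 1 / 2 ≤ Real.log ((H : ℝ) / U) := half_le_log (by rwa [le_div_iff₀ hU'])
  have hsqrt : (U : ℝ) ≤ √((U : ℝ) * H) := Real.le_sqrt_of_sq_le (by nlinarith)
  have hbound := E.lintegral_sum_gap_le S rfl
    (E.sum_radius_mul_le (shiftedLinUCB DT DG source confidenceRadius) S hd hU hH)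
  rw [integral_eq_lintegral_of_nonneg_ae
    (Filter.Eventually.of_forall fun ω => Finset.sum_nonneg fun h _ => E.gap_nonneg _ h ω)
    (Finset.measurable_fun_sum _ fun h hh =>
      E.measurable_gap (Finset.mem_range.1 hh)).aestronglyMeasurable]
  have h4 : (4 * U : ENNReal) = ENNReal.ofReal (4 * U) := by
    rw [ENNReal.ofReal_mul (by norm_num), ENNReal.ofReal_natCast, ENNReal.ofReal_ofNat]
  rw [h4, ← ENNReal.ofReal_add (by positivity) (by positivity)] at hbound
  refine (ENNReal.toReal_le_of_le_ofReal (by positivity) hbound).trans ?_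
  have h5 : (U : ℝ) ≤ d * √((U : ℝ) * H) := hsqrt.trans (le_mul_of_one_le_left (by positivity) hd')
  have h6 : 0 ≤ (d : ℝ) * √((U : ℝ) * H) := by positivity
  -- The widths give `2 * 34 = 68`; since `log (H / U) ≥ 1 / 2`, the term `4 U` costs at most `8`
  -- more, within `100`.
  nlinarith [mul_le_mul_of_nonneg_left hlog h6]

end Expectation

/-! ### From the decomposition to the bandit, and the main theorem -/

theorem Decomposition.isShift {a b n r d U : ℕ} {A : Matrix (Fin a) (Fin n) ℝ}
    {B : Matrix (Fin b) (Fin n) ℝ} (D : Decomposition A B r d) (θ : Fin U → Fin n → ℝ)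
    (hθ : ∀ u, ‖WithLp.toLp 2 (B *ᵥ θ u)‖ ≤ 1) :
    IsShift (fun u => B *ᵥ θ u) D.transformer D.generator (fun u => A *ᵥ θ u)
      (fun u => D.generatorᵀ *ᵥ (B *ᵥ θ u)) := by
  have hle : ∀ u, (B *ᵥ θ u) ⬝ᵥ (B *ᵥ θ u) ≤ 1 := fun u => by
    rw [← norm_toLp_sq]
    exact pow_le_one₀ (norm_nonneg _) (hθ u)
  refine ⟨dotProduct_transpose_mulVec_le D.generator_orthonormal, fun u x => ?_, hle, fun u =>
    (dotProduct_transpose_mulVec_le D.generator_orthonormal _).trans (hle u)⟩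
  obtain ⟨ψ, hψ⟩ := D.exists_param (θ u)
  rw [← D.param_eq hψ]
  conv_lhs => rw [hψ]
  rw [dotProduct_add, dotProduct_mulVec x D.generator, ← mulVec_transpose]

end SkylineBandit

end

theorem mainTheorem3 :
    ∃ C : ℝ, 0 < C ∧ ∃ radius : ℕ → ℕ → ℝ, (∀ d t, 0 < radius d t) ∧
      ∀ (n a b : ℕ) (A : Matrix (Fin a) (Fin n) ℝ) (B : Matrix (Fin b) (Fin n) ℝ),
        A.rank = a → B.rank = b →
        (∃ r d : ℕ, Nonempty (SkylineBandit.Decomposition A B r d)) ∧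
        ∀ (r d : ℕ) (D : SkylineBandit.Decomposition A B r d),
          (r : ℝ) = a + (1 - SkylineBandit.commonInformation A B) * b ∧
          (d : ℝ) = (1 - SkylineBandit.commonInformation A B) * b ∧
          (∀ θ : Fin n → ℝ, ∃! ψ : Fin d → ℝ,
            B.mulVec θ = D.transformer.mulVec (A.mulVec θ) + D.generator.mulVec ψ) ∧
          ∀ (U H : ℕ) (θ : Fin U → Fin n → ℝ),
            (∀ u, ‖WithLp.toLp 2 (θ u)‖ ≤ 1) →
            (∀ u, ‖WithLp.toLp 2 (B.mulVec (θ u))‖ ≤ 1) →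
            2 * U ≤ H →
            ∀ (Ω : Type*) [MeasurableSpace Ω] (P : MeasureTheory.Measure Ω)
              [MeasureTheory.IsProbabilityMeasure P]
              (E : SkylineBandit.Environment P U b H),
              MeasureTheory.Integrable
                (E.realizedRegret (fun u => B.mulVec (θ u))
                  (SkylineBandit.shiftedLinUCB D.transformer D.generator
                    (fun u => A.mulVec (θ u)) radius)) P ∧
              ∫ ω, E.realizedRegret (fun u => B.mulVec (θ u))
                  (SkylineBandit.shiftedLinUCB D.transformer D.generator
                    (fun u => A.mulVec (θ u)) radius) ω ∂P ≤
                C * ((1 - SkylineBandit.commonInformation A B) * b) *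
                  √((U : ℝ) * H) * Real.log ((H : ℝ) / U) := by
  refine ⟨100, by norm_num, SkylineBandit.confidenceRadius, SkylineBandit.confidenceRadius_pos,
    fun n a b A B hA hB => ⟨SkylineBandit.exists_decomposition hA, fun r d D => ?_⟩⟩
  have h1 : (r : ℝ) + SkylineBandit.commonInformation A B * b = a + b := by
    rw [SkylineBandit.commonInformation_mul]
    exact_mod_cast D.rank_add hA hB
  have h2 : (d : ℝ) + a = r := by exact_mod_cast D.dim_add hA
  have hd : (d : ℝ) = (1 - SkylineBandit.commonInformation A B) * b := by linarith
  refine ⟨by linarith, hd, fun θ => ?_, fun U H θ _ hB hH Ω _ P _ E => ?_⟩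
  · obtain ⟨ψ, hψ⟩ := D.exists_param θ
    exact ⟨ψ, hψ, fun φ hφ => (D.param_eq hφ).trans (D.param_eq hψ).symm⟩
  · have S := D.isShift θ hB
    rw [← hd]
    exact ⟨E.integrable_realizedRegret S, E.integral_realizedRegret_le S hH⟩
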